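/- Let $\Sigma=\{0,1,\dots,\sigma-1\}$ and let $T[1,n]\in\Sigma^n$, $n\ge 2$, $\sigma\le n$, be a text, i.e. its last character is the smallest character $\$=0$ and $\$$ occurs nowhere else in $T$. Let $\overline T=T[n-1]\cdots T[1]\,\$$, and let $\mathrm{SA}$, $\mathrm{LCP}$ and $\mathrm{BWT}$ be the suffix array, the longest-common-prefix array and the Burrows--Wheeler transform of $\overline T$: $\mathrm{SA}$ lists the positions $1,\dots,n$ in the lexicographic order of the suffixes of $\overline T$ starting there, $\mathrm{LCP}[i]$ ($2\le i\le n$) is the length of the longest common prefix of the suffixes starting at $\mathrm{SA}[i-1]$ and $\mathrm{SA}[i]$, and $\mathrm{BWT}[i]=\overline T[\mathrm{SA}[i]-1]$ with $\overline T[0]=\$$. Let $\bar r$ be the number of runs (maximal blocks of equal characters) of $\mathrm{BWT}$. A string $\beta$ is right-maximal in $T$ if it is a suffix of $T$ or if $\beta a$ and $\beta b$ are both substrings of $T$ for two distinct characters $a,b$. A set $S\subseteq\{1,\dots,n\}$ is suffixient for $T$ if for all $1\le i\le j\le n$ such that $T[i,j-1]$ is right-maximal there is $x\in S$ such that $T[i,j]$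 is a suffix of $T[1,x]$. The one-pass algorithm maintains a set $\mathcal S$, a value $m$, and an entry $R[c]=(\mathit{len},\mathit{pos},\mathit{active})$ for each $c\in\Sigma$. The procedure $\mathrm{eval}(l)$ does the following for each $c\in\Sigma$ with $l<R[c].\mathit{len}$: if $R[c].\mathit{active}$, add $R[c].\mathit{pos}$ to $\mathcal S$; then set $R[c]\gets(l,0,\mathit{false})$. Initially $\mathcal S=\emptyset$, $m=\infty$ and $R[c]=(-1,0,\mathit{false})$ for all $c$. For $i=2,\dots,n$: set $m\gets\min\{m,\mathrm{LCP}[i]\}$; if $\mathrm{BWT}[i]\ne\mathrm{BWT}[i-1]$, then call $\mathrm{eval}(m)$, next for $i'=i-1$ and $i'=i$ set $R[\mathrm{BWT}[i']]\gets(\mathrm{LCP}[i],\,n-\mathrm{SA}[i']+1,\,\mathit{true})$ provided that $\mathrm{LCP}[i]>R[\mathrm{BWT}[i']].\mathit{len}$, and finally set $m\gets\infty$. After the loop call $\mathrm{eval}(-1)$ and return $\mathcal S$. Then the set $\mathcal S$ returned by the one-pass algorithm is a suffixient set of smallest cardinality for $T$. Moreover, the algorithm can be implemented in $O(n+\bar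 r\log\sigma)$ time and $O(n)$ words of space with a single streaming pass: there are one word-RAM program and one constant $C$ such that, for all $\sigma$ and $T$ as above, the program, given $n$ and $\sigma$ and the triples $(\mathrm{BWT}[i],\mathrm{LCP}[i],\mathrm{SA}[i])$, $i=1,\dots,n$ (where $\mathrm{LCP}[1]$ is the placeholder $0$), as a read-once left-to-right input stream, outputs the elements of $\mathcal S$, each exactly once, and halts after at most $C\,(n+\bar r\log_2\sigma)$ unit-cost steps, using at most $C\,n$ memory cells and a constant number of registers, all of which hold only integers in $[0,C\,n)$. -/

import Mathlib

namespace Suffixient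

/-! ### Texts, suffix array, LCP array, Burrows-Wheeler transform

Strings are lists; text positions are 1-based, so `T[i..j]` is `(T.take j).drop (i - 1)`. -/

/-- A text over the ordered alphabet `Fin σ`: a string of length at least 2 whose last character is
the smallest character `$` (the one of value `0`), which occurs nowhere else. -/
def IsText {σ : ℕ} (T : List (Fin σ)) : Prop :=
  2 ≤ T.length ∧ ∃ (u : List (Fin σ)) (d : Fin σ), T = u ++ [d] ∧ (d : ℕ) = 0 ∧ d ∉ u

/-- The reverse `T[n-1] ⋯ T[1] T[n]` of a text, which keeps the end marker at the end. -/
def revText {α : Type*} (T : List α) : List α :=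
  T.dropLast.reverse ++ T.getLast?.toList

/-- The suffix of `w` that starts at the (1-based) position `k`. -/
def suffixAt {α : Type*} (w : List α) (k : ℕ) : List α :=
  w.drop (k - 1)

/-- The suffix array: the positions `1, …, |w|`, sorted by the lexicographic order of the suffixes
that start there. -/
def suffixArray {α : Type*} [LinearOrder α] (w : List α) : List ℕ :=
  (List.range' 1 w.length).insertionSort (fun i j => suffixAt w i ≤ suffixAt w j)

/-- Length of the longest common prefix of two strings. -/
def lcpLen {α : Type*} [DecidableEq α] : List α → List α → ℕ
  | a :: u, b :: v => if a = b then lcpLen u v + 1 else 0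
  | _, _ => 0

/-- The LCP array. Its first entry, which the usual definition leaves undefined, is the placeholder
`0`; the entry of index `i ≥ 2` is the length of the longest common prefix of the `(i-1)`-th and
the `i`-th smallest suffix. -/
def lcpArray {α : Type*} [LinearOrder α] (w : List α) : List ℕ :=
  0 :: List.zipWith (fun k l => lcpLen (suffixAt w k) (suffixAt w l))
    (suffixArray w) (suffixArray w).tail

/-- The Burrows-Wheeler transform: the character cyclically preceding each suffix, the suffixes
being taken in lexicographic order. (The 1-based position `k - 1` is the list index `k - 2`.) -/
def bwt {α : Type*} [LinearOrder α] (w : List α) : List α :=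
  (suffixArray w).filterMap (fun k => if k = 1 then w.getLast? else w[k - 2]?)

/-- The number of runs (maximal blocks of equal characters) of a string. -/
def runs {α : Type*} [DecidableEq α] (w : List α) : ℕ :=
  (w.splitBy (fun a b => a == b)).length

/-- The number of runs of the Burrows-Wheeler transform of the reversed text. -/
def rBar {α : Type*} [LinearOrder α] (T : List α) : ℕ :=
  runs (bwt (revText T))

/-- The triples `(BWT[i], LCP[i], SA[i])`, `i = 1, …, n`, of the reversed text. -/
def arrays {α : Type*} [LinearOrder α] (T : List α) : List (α × ℕ × ℕ) :=
  (bwt (revText T)).zip ((lcpArray (revText T)).zip (suffixArray (revText T)))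

/-! ### Suffixient sets -/

/-- `β` is a right-maximal substring of `T`: it is a suffix of `T`, or it can be extended to the
right within `T` by two distinct characters. -/
def RightMaximal {α : Type*} (T β : List α) : Prop :=
  β <:+ T ∨ ∃ a b : α, a ≠ b ∧ (β ++ [a]) <:+: T ∧ (β ++ [b]) <:+: T

/-- `S ⊆ [n]` is suffixient for `T`: each one-character right-extension `T[i..j]` of a right-maximal
string `T[i..j-1]` is a suffix of `T[1..x]` for some `x ∈ S`. -/
def IsSuffixient {α : Type*} (T : List α) (S : Finset ℕ) : Prop :=
  S ⊆ Finset.Icc 1 T.length ∧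
    ∀ i j : ℕ, 1 ≤ i → i ≤ j → j ≤ T.length →
      RightMaximal T ((T.take (j - 1)).drop (i - 1)) →
        ∃ x ∈ S, (T.take j).drop (i - 1) <:+ T.take x

/-- A suffixient set of smallest cardinality. -/
def IsSmallestSuffixient {α : Type*} (T : List α) (S : Finset ℕ) : Prop :=
  IsSuffixient T S ∧ ∀ S' : Finset ℕ, IsSuffixient T S' → S.card ≤ S'.card

/-! ### The one-pass algorithm -/

/-- An entry of the table `R`. -/
structure Candidate where
  len : ℤ
  pos : ℕ
  active : Bool

/-- The variables of the one-pass algorithm; `m = none` stands for `m = ∞`. -/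
structure OnePassState (σ : ℕ) where
  S : Finset ℕ
  R : Fin σ → Candidate
  m : Option ℕ

/-- The procedure `eval(Σ, l, R, 𝒮)`. The iterations of its loop over the characters `c ∈ Σ` touch
disjoint entries of `R`, and so are performed simultaneously. -/
def eval {σ : ℕ} (l : ℤ) (st : OnePassState σ) : OnePassState σ :=
  { S := st.S ∪ (Finset.univ.filter
      (fun c => l < (st.R c).len ∧ (st.R c).active = true)).image (fun c => (st.R c).pos)
    R := fun c => if l < (st.R c).len then ⟨l, 0, false⟩ else st.R c
    m := st.m }

/-- `if lcp > R[c].len then R[c] ← (lcp, pos, true)`. -/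
def activate {σ : ℕ} (lcp pos : ℕ) (c : Fin σ) (st : OnePassState σ) : OnePassState σ :=
  if (st.R c).len < (lcp : ℤ) then
    { st with R := Function.update st.R c ⟨lcp, pos, true⟩ }
  else st

/-- The body of the main loop for an index `i`, given the triples of index `i - 1` and `i`. -/
def onePassStep {σ : ℕ} (n : ℕ) (st : OnePassState σ)
    (p : (Fin σ × ℕ × ℕ) × (Fin σ × ℕ × ℕ)) : OnePassState σ :=
  match p with
  | ((b', _, s'), (b, l, s)) =>
    let m : ℕ := match st.m with
      | none => l
      | some k => min k l
    if b ≠ b' then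
      { activate l (n - s + 1) b (activate l (n - s' + 1) b' (eval (m : ℤ) st)) with m := none }
    else
      { st with m := some m }

/-- The initial values of the variables. -/
def onePassInit (σ : ℕ) : OnePassState σ :=
  { S := ∅, R := fun _ => ⟨-1, 0, false⟩, m := none }

/-- The set returned by the one-pass algorithm on the text `T`. -/
def onePass {σ : ℕ} (T : List (Fin σ)) : Finset ℕ :=
  (eval (-1) (((arrays T).zip (arrays T).tail).foldl
    (onePassStep T.length) (onePassInit σ))).S

/-! ### A streaming word RAM

A program works on finitely many registers and on a random access memory. Its input is a one-way
stream of triples of numbers, which can only be read from left to right, each triple once; its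
output is a one-way stream of numbers. -/

/-- Programs; `x`, `y`, `z` are names of registers. -/
inductive Prog where
  /-- do nothing -/
  | skip
  /-- `x := k` for a constant `k` -/
  | const (x k : ℕ)
  /-- `x := y` -/
  | copy (x y : ℕ)
  /-- `x := y + z` -/
  | add (x y z : ℕ)
  /-- `x := y - z` (truncated at `0`) -/
  | sub (x y z : ℕ)
  /-- `x := memory[y]` -/
  | load (x y : ℕ)
  /-- `memory[x] := y` -/
  | store (x y : ℕ)
  /-- read the next triple of the input stream into `x`, `y`, `z` -/
  | read (x y z : ℕ)
  /-- append the content of `x` to the output stream -/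
  | write (x : ℕ)
  | seq (p q : Prog)
  /-- `if x < y then p else q` -/
  | ite (x y : ℕ) (p q : Prog)
  /-- `while x < y do p` -/
  | loop (x y : ℕ) (p : Prog)

structure State where
  reg : ℕ → ℕ
  mem : ℕ → ℕ
  inp : List (ℕ × ℕ × ℕ)
  out : List ℕ

def State.set (s : State) (x v : ℕ) : State :=
  { s with reg := Function.update s.reg x v }

/-- `Exec W M p s t s'`: on a machine with `M` memory cells (of addresses `0, …, M - 1`) and words
that hold the numbers `0, …, W - 1`, program `p`, started in state `s`, halts in state `s'` after
exactly `t` steps. Each instruction and each test counts as one step. There is no execution if a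
number that does not fit a word is produced or read, if an address outside of the memory is used, or
if the program reads beyond the end of the input stream. -/
inductive Exec (W M : ℕ) : Prog → State → ℕ → State → Prop where
  | skip (s : State) : Exec W M .skip s 1 s
  | const (s : State) (x k : ℕ) (h : k < W) : Exec W M (.const x k) s 1 (s.set x k)
  | copy (s : State) (x y : ℕ) : Exec W M (.copy x y) s 1 (s.set x (s.reg y))
  | add (s : State) (x y z : ℕ) (h : s.reg y + s.reg z < W) :
      Exec W M (.add x y z) s 1 (s.set x (s.reg y + s.reg z))
  | sub (s : State) (x y z : ℕ) : Exec W M (.sub x y z) s 1 (s.set x (s.reg y - s.reg z))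
  | load (s : State) (x y : ℕ) (h : s.reg y < M) :
      Exec W M (.load x y) s 1 (s.set x (s.mem (s.reg y)))
  | store (s : State) (x y : ℕ) (h : s.reg x < M) :
      Exec W M (.store x y) s 1 { s with mem := Function.update s.mem (s.reg x) (s.reg y) }
  | read (s : State) (x y z a b c : ℕ) (rest : List (ℕ × ℕ × ℕ)) (h : s.inp = (a, b, c) :: rest)
      (ha : a < W) (hb : b < W) (hc : c < W) :
      Exec W M (.read x y z) s 1 { ((s.set x a).set y b).set z c with inp := rest }
  | write (s : State) (x : ℕ) : Exec W M (.write x) s 1 { s with out := s.out ++ [s.reg x] }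
  | seq (p q : Prog) (s s' s'' : State) (t t' : ℕ) (hp : Exec W M p s t s')
      (hq : Exec W M q s' t' s'') : Exec W M (.seq p q) s (t + t') s''
  | ite_true (x y : ℕ) (p q : Prog) (s s' : State) (t : ℕ) (h : s.reg x < s.reg y)
      (hp : Exec W M p s t s') : Exec W M (.ite x y p q) s (t + 1) s'
  | ite_false (x y : ℕ) (p q : Prog) (s s' : State) (t : ℕ) (h : ¬ s.reg x < s.reg y)
      (hq : Exec W M q s t s') : Exec W M (.ite x y p q) s (t + 1) s'
  | loop_true (x y : ℕ) (p : Prog) (s s' s'' : State) (t t' : ℕ) (h : s.reg x < s.reg y)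
      (hp : Exec W M p s t s') (hl : Exec W M (.loop x y p) s' t' s'') :
      Exec W M (.loop x y p) s (t + t' + 1) s''
  | loop_false (x y : ℕ) (p : Prog) (s : State) (h : ¬ s.reg x < s.reg y) :
      Exec W M (.loop x y p) s 1 s

/-- The initial state on the text `T`: registers `0` and `1` hold the text length and the alphabet
size, all other registers and the memory are zero, the input stream carries the triples
`(BWT[i], LCP[i], SA[i])` of the reversed text for `i = 1, …, n`, characters being represented by
their ranks `0, …, σ - 1`, and the output stream is empty. -/
def initState {σ : ℕ} (T : List (Fin σ)) : State where
  reg := fun x => if x = 0 then T.length else if x = 1 then σ else 0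
  mem := fun _ => 0
  inp := (arrays T).map (fun p => ((p.1 : ℕ), p.2.1, p.2.2))
  out := []

end Suffixient

/-!
Read backwards, the suffixes of the reversed text are the prefixes of the text. Hence the minimum of
the LCP array between two ranks is the length of the longest common suffix of two prefixes, and the
BWT character at a rank is the one that extends this prefix to the right. A right-maximal string
that `c` extends is thus witnessed by a run boundary of the BWT that involves `c`; call these
boundaries the candidates for `c`, each with the LCP value there as its level. Select a candidate
if, without passing an LCP value below its level, one reaches neither a candidate for `c` of greater
level nor an earlier one of equal level. The one-pass algorithm outputs exactly the selected
candidates. They form a suffixient set, because from every candidate one reaches a selected one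
without passing a value below the level of the former. Every other suffixient set contains, for each
selected candidate, a position preceded by a common suffix of the length of its level and carrying
`c`; these positions are distinct, because between two selected candidates for `c` the LCP drops
below both of their levels.

A call of `eval` touches all entries of the table, which is too slow. As successive calls of `eval`
amount to one with the least threshold, the program delays them and accumulates `n - l`, whose
maximum is the pending update, at the nodes of a complete binary tree over the alphabet: an update
of all entries is recorded at the root, and before an entry is used, the updates on the path to its
leaf are pushed down. This costs `O(log σ)` steps for each run boundary.
-/

namespace Suffixient

/-! ### Strings and arrays -/

section Strings

variable {α : Type*}

theorem le_lcpLen_iff [DecidableEq α] (l : ℕ) (u v : List α) :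
    l ≤ lcpLen u v ↔ l ≤ u.length ∧ l ≤ v.length ∧ u.take l = v.take l := by
  induction l generalizing u v with
  | zero => simp
  | succ l ih =>
    rcases u with _ | ⟨a, u⟩ <;> rcases v with _ | ⟨b, v⟩ <;> try simp [lcpLen]
    by_cases h : a = b <;> simp [h, ih]

theorem cons_le_cons_iff_lt_or [LinearOrder α] {a b : α} {u v : List α} :
    a :: u ≤ b :: v ↔ a < b ∨ a = b ∧ u ≤ v := by
  rw [← not_lt, List.cons_lt_cons_iff, ← not_lt (a := v)]
  rcases lt_trichotomy a b with h | rfl | h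
  · simp [h, h.not_gt, h.ne']
  · simp
  · simp [h, h.not_gt, h.ne']

theorem lcpLen_of_le_of_le [LinearOrder α] {u v w : List α} (huv : u ≤ v) (hvw : v ≤ w) :
    lcpLen u w = min (lcpLen u v) (lcpLen v w) := by
  induction u generalizing v w with
  | nil => simp [lcpLen]
  | cons a u ih =>
    rcases v with _ | ⟨b, v⟩
    · exact absurd List.Lex.nil huv.not_gt
    rcases w with _ | ⟨c, w⟩
    · exact absurd List.Lex.nil hvw.not_gt
    rcases cons_le_cons_iff_lt_or.1 huv with hab | ⟨rfl, huv'⟩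
    · have hac : a ≠ c := (hab.trans_le (by
        rcases cons_le_cons_iff_lt_or.1 hvw with hbc | ⟨rfl, -⟩
        exacts [hbc.le, le_rfl])).ne
      simp [lcpLen, hab.ne, hac]
    · rcases cons_le_cons_iff_lt_or.1 hvw with hac | ⟨rfl, hvw'⟩
      · simp [lcpLen, hac.ne]
      · simp [lcpLen, ih huv' hvw']

theorem le_lcpLen_iff_forall_adjacent [LinearOrder α] {f : ℕ → List α} {n : ℕ}
    (hf : MonotoneOn f (Set.Iio n)) {k k' : ℕ} (h : k < k') (hk' : k' < n) (l : ℕ) :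
    l ≤ lcpLen (f k) (f k') ↔ ∀ t ∈ Set.Ioc k k', l ≤ lcpLen (f (t - 1)) (f t) := by
  induction k', h using Nat.le_induction with
  | base => simp [Nat.Ioc_succ_singleton, ← Finset.coe_Ioc]
  | succ m hm ih =>
    have hIoc : Set.Ioc k (m + 1) = insert (m + 1) (Set.Ioc k m) := by
      ext t
      simp only [Set.mem_Ioc, Set.mem_insert_iff]
      omega
    have hk : k ≤ m := by omega
    rw [lcpLen_of_le_of_le (hf (by simp; omega) (by simp; omega) hk)
      (hf (by simp; omega) (by simpa using hk') m.le_succ), le_min_iff, ih (by omega), hIoc]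
    simp [and_comm]

/-- The prefixes of `T` of lengths `y` and `y'` have a common suffix of length `l`. -/
def CommonSuffix (T : List α) (l y y' : ℕ) : Prop :=
  l ≤ y ∧ l ≤ y' ∧ (T.take y).drop (y - l) = (T.take y').drop (y' - l)

namespace CommonSuffix

variable {T : List α} {l m y y' y'' : ℕ}

theorem refl (h : l ≤ y) : CommonSuffix T l y y :=
  ⟨h, h, rfl⟩

theorem symm (h : CommonSuffix T l y y') : CommonSuffix T l y' y :=
  ⟨h.2.1, h.1, h.2.2.symm⟩

theorem trans (h : CommonSuffix T l y y') (h' : CommonSuffix T l y' y'') :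
    CommonSuffix T l y y'' :=
  ⟨h.1, h'.2.1, h.2.2.trans h'.2.2⟩

theorem mono (h : CommonSuffix T l y y') (hm : m ≤ l) : CommonSuffix T m y y' := by
  obtain ⟨hy, hy', heq⟩ := h
  refine ⟨hm.trans hy, hm.trans hy', ?_⟩
  have hdrop := congrArg (List.drop (l - m)) heq
  rw [List.drop_drop, List.drop_drop] at hdrop
  rwa [show y - m = y - l + (l - m) by omega, show y' - m = y' - l + (l - m) by omega]

end CommonSuffix

theorem take_reverse_take_append_eq_iff {u : List α} {d : α} {l y y' : ℕ} (hy : y ≤ u.length)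
    (hy' : y' ≤ u.length) (hl : l ≤ y) (hl' : l ≤ y') :
    ((u.take y).reverse ++ [d]).take l = ((u.take y').reverse ++ [d]).take l ↔
      CommonSuffix (u ++ [d]) l y y' := by
  rw [CommonSuffix, List.take_append_of_le_length (by simp; omega),
    List.take_append_of_le_length (by simp; omega), List.take_reverse, List.take_reverse,
    List.take_append_of_le_length hy, List.take_append_of_le_length hy', List.reverse_inj]
  simp [hy, hy', hl, hl']

theorem le_of_le_lcpLen_reverse_take [DecidableEq α] {u : List α} {d : α} (hd : d ∉ u)
    {l y y' : ℕ} (hy : y ≤ u.length) (hy' : y' ≤ u.length) (hne : y ≠ y')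
    (h : l ≤ lcpLen ((u.take y).reverse ++ [d]) ((u.take y').reverse ++ [d])) : l ≤ y := by
  by_contra! hlt
  obtain ⟨-, hlen, heq⟩ := (le_lcpLen_iff (y + 1) _ _).1 (Nat.succ_le_of_lt hlt |>.trans h)
  simp only [List.length_append, List.length_reverse, List.length_take, List.length_singleton,
    min_eq_left hy'] at hlen
  rw [List.take_append_of_le_length (i := y + 1) (l₁ := (u.take y').reverse) (by simp; omega),
    List.take_of_length_le (by simp)] at heq
  have hmem : d ∈ ((u.take y').reverse).take (y + 1) := by simp [← heq]
  exact hd (List.mem_of_mem_take (List.mem_reverse.1 (List.mem_of_mem_take hmem)))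

theorem lcpLen_comm [DecidableEq α] (u v : List α) : lcpLen u v = lcpLen v u :=
  eq_of_forall_le_iff fun l => by
    rw [le_lcpLen_iff, le_lcpLen_iff, and_left_comm, eq_comm]

theorem le_lcpLen_reverse_take_iff [DecidableEq α] {u : List α} {d : α} (hd : d ∉ u) {y y' : ℕ}
    (hy : y ≤ u.length) (hy' : y' ≤ u.length) (hne : y ≠ y') (l : ℕ) :
    l ≤ lcpLen ((u.take y).reverse ++ [d]) ((u.take y').reverse ++ [d]) ↔
      CommonSuffix (u ++ [d]) l y y' := by
  constructor
  · intro h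
    have hl := le_of_le_lcpLen_reverse_take hd hy hy' hne h
    have hl' := le_of_le_lcpLen_reverse_take (l := l) hd hy' hy hne.symm (by rwa [lcpLen_comm])
    rw [le_lcpLen_iff] at h
    exact (take_reverse_take_append_eq_iff hy hy' hl hl').1 h.2.2
  · intro h
    refine (le_lcpLen_iff _ _ _).2
      ⟨?_, ?_, (take_reverse_take_append_eq_iff hy hy' h.1 h.2.1).2 h⟩
    · simpa [hy] using h.1.trans y.le_succ
    · simpa [hy'] using h.2.1.trans y'.le_succ

end Strings

section Arrays

variable {α : Type*}

theorem revText_append_singleton (u : List α) (d : α) : revText (u ++ [d]) = u.reverse ++ [d] := by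
  simp [revText]

theorem suffixAt_reverse_append_singleton (u : List α) (d : α) {k : ℕ} (h1 : 1 ≤ k)
    (h2 : k ≤ u.length + 1) :
    suffixAt (u.reverse ++ [d]) k = (u.take (u.length + 1 - k)).reverse ++ [d] := by
  rw [suffixAt, List.drop_append_of_le_length (by simp; omega), List.drop_reverse,
    show u.length - (k - 1) = u.length + 1 - k by omega]

theorem eq_map_getD_range (l : List α) (d : α) :
    l = (List.range l.length).map fun k => l.getD k d :=
  List.ext_getElem (by simp) fun i h _ => by simp [h]

variable [LinearOrder α]

theorem suffixArray_perm (w : List α) : (suffixArray w).Perm (List.range' 1 w.length) :=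
  List.perm_insertionSort _ _

theorem length_suffixArray (w : List α) : (suffixArray w).length = w.length := by
  simp [suffixArray]

theorem mem_suffixArray {w : List α} {x : ℕ} :
    x ∈ suffixArray w ↔ 1 ≤ x ∧ x ≤ w.length := by
  rw [(suffixArray_perm w).mem_iff, List.mem_range'_1]
  omega

theorem getD_suffixArray_mem {w : List α} {k : ℕ} (hk : k < w.length) :
    (suffixArray w).getD k 0 ∈ suffixArray w := by
  rw [List.getD_eq_getElem _ _ (by rwa [length_suffixArray])]
  exact List.getElem_mem _

theorem bijOn_getD_suffixArray (w : List α) :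
    Set.BijOn ((suffixArray w).getD · 0) (Set.Iio w.length) (Set.Icc 1 w.length) := by
  refine ⟨fun k hk => mem_suffixArray.1 (getD_suffixArray_mem hk), fun k hk k' hk' h => ?_,
    fun x hx => ?_⟩
  · have hnodup : (suffixArray w).Nodup :=
      (suffixArray_perm w).nodup_iff.2 List.nodup_range'
    rw [Set.mem_Iio, ← length_suffixArray w] at hk hk'
    simpa [hk, hk', hnodup.getElem_inj_iff] using h
  · obtain ⟨k, hk, rfl⟩ := List.mem_iff_getElem.1 (mem_suffixArray.2 hx)
    exact ⟨k, by simpa [length_suffixArray] using hk, by simp [hk]⟩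

theorem monotoneOn_suffixAt_suffixArray (w : List α) :
    MonotoneOn (fun k => suffixAt w ((suffixArray w).getD k 0)) (Set.Iio w.length) := by
  let r : ℕ → ℕ → Prop := fun i j => suffixAt w i ≤ suffixAt w j
  have : Std.Total r := ⟨fun i j => le_total _ _⟩
  have : IsTrans ℕ r := ⟨fun i j k => le_trans⟩
  intro i hi j hj hij
  rw [Set.mem_Iio, ← length_suffixArray w] at hi hj
  rcases hij.eq_or_lt with rfl | hij
  · exact le_rfl
  · have hsorted : (suffixArray w).Pairwise r := List.pairwise_insertionSort r _
    simpa [hi, hj] using List.pairwise_iff_getElem.1 hsorted i j hi hj hij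

theorem length_lcpArray {w : List α} (hw : w ≠ []) : (lcpArray w).length = w.length := by
  have := List.length_pos_iff.2 hw
  simp [lcpArray, length_suffixArray]
  omega

theorem getD_lcpArray {w : List α} {k : ℕ} (h0 : 0 < k) (hk : k < w.length) :
    (lcpArray w).getD k 0 = lcpLen (suffixAt w ((suffixArray w).getD (k - 1) 0))
      (suffixAt w ((suffixArray w).getD k 0)) := by
  obtain ⟨k, rfl⟩ := Nat.exists_eq_succ_of_ne_zero h0.ne'
  have hk' : k < w.length := k.lt_succ_self.trans hk
  have hlt : k < (List.zipWith (fun k l => lcpLen (suffixAt w k) (suffixAt w l))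
      (suffixArray w) (suffixArray w).tail).length := by
    simp [length_suffixArray]
    omega
  rw [lcpArray, List.getD_cons_succ, List.getD_eq_getElem _ _ hlt]
  simp [length_suffixArray, hk, hk']

theorem forall_le_getD_lcpArray_iff {w : List α} {k k' : ℕ} (h : k < k') (hk' : k' < w.length)
    (l : ℕ) :
    (∀ t ∈ Set.Ioc k k', l ≤ (lcpArray w).getD t 0) ↔
      l ≤ lcpLen (suffixAt w ((suffixArray w).getD k 0))
        (suffixAt w ((suffixArray w).getD k' 0)) := by
  rw [le_lcpLen_iff_forall_adjacent (monotoneOn_suffixAt_suffixArray w) h hk']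
  exact forall₂_congr fun t ht => by
    rw [getD_lcpArray (k.zero_le.trans_lt ht.1) (ht.2.trans_lt hk')]

theorem bwt_reverse_append_singleton (u : List α) (d : α) :
    bwt (u.reverse ++ [d]) = (suffixArray (u.reverse ++ [d])).map
      fun x => (u ++ [d]).getD (u.length + 1 - x) d := by
  rw [bwt, List.filterMap_eq_map_iff_forall_eq_some]
  intro x hx
  obtain ⟨hx1, hx2⟩ := mem_suffixArray.1 hx
  simp only [List.length_append, List.length_reverse, List.length_singleton] at hx2
  rcases hx1.eq_or_lt' with rfl | hx1
  · simp
  · rw [if_neg (by omega), List.getElem?_append_left (by simp; omega),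
      List.getElem?_reverse (by omega), List.getD_eq_getElem?_getD,
      List.getElem?_append_left (by omega), List.getElem?_eq_getElem (by omega),
      List.getElem?_eq_getElem (by omega), Option.getD_some]
    congr 2
    omega

/-- The arrays of the reverse of `T`, as functions of an index that starts from `0`: `b` is the
Burrows-Wheeler transform, `L` the LCP array, and the suffix array is `T.length - y`. The suffix of
rank `k` is the reverse of the prefix of `T` of length `y k`, followed by the end marker; in `T`
that prefix is followed by the character `b k`. -/
structure IsArrays (T : List α) (b : ℕ → α) (L y : ℕ → ℕ) : Prop where
  arrays_eq : arrays T = (List.range T.length).map fun k => (b k, L k, T.length - y k)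
  bwt_eq : bwt (revText T) = (List.range T.length).map b
  bijOn : Set.BijOn y (Set.Iio T.length) (Set.Iio T.length)
  getElem?_eq : ∀ k < T.length, T[y k]? = some (b k)
  lcp_zero : L 0 = 0
  le_lcp_iff : ∀ k k', k < k' → k' < T.length → ∀ l,
    (∀ t ∈ Set.Ioc k k', l ≤ L t) ↔ CommonSuffix T l (y k) (y k')

theorem forall_le_getD_lcpArray_iff_commonSuffix {u : List α} {d : α} (hd : d ∉ u) {k k' : ℕ}
    (h : k < k') (hk' : k' < u.length + 1) (l : ℕ) :
    (∀ t ∈ Set.Ioc k k', l ≤ (lcpArray (u.reverse ++ [d])).getD t 0) ↔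
      CommonSuffix (u ++ [d]) l (u.length + 1 - (suffixArray (u.reverse ++ [d])).getD k 0)
        (u.length + 1 - (suffixArray (u.reverse ++ [d])).getD k' 0) := by
  have hlen : (u.reverse ++ [d]).length = u.length + 1 := by simp
  have hbij := hlen ▸ bijOn_getD_suffixArray (u.reverse ++ [d])
  rw [forall_le_getD_lcpArray_iff h (hk'.trans_eq hlen.symm)]
  set sa := fun k => (suffixArray (u.reverse ++ [d])).getD k 0
  have hmem : 1 ≤ sa k ∧ sa k ≤ u.length + 1 := hbij.mapsTo (h.trans hk')
  have hmem' : 1 ≤ sa k' ∧ sa k' ≤ u.length + 1 := hbij.mapsTo hk'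
  have hne : sa k ≠ sa k' := fun heq => h.ne (hbij.injOn (h.trans hk') hk' heq)
  change l ≤ lcpLen (suffixAt _ (sa k)) (suffixAt _ (sa k')) ↔
    CommonSuffix _ l (u.length + 1 - sa k) (u.length + 1 - sa k')
  rw [suffixAt_reverse_append_singleton u d hmem.1 hmem.2,
    suffixAt_reverse_append_singleton u d hmem'.1 hmem'.2]
  apply le_lcpLen_reverse_take_iff hd <;> omega

theorem exists_isArrays {u : List α} {d : α} (hd : d ∉ u) :
    ∃ (b : ℕ → α) (L y : ℕ → ℕ), IsArrays (u ++ [d]) b L y := by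
  set n := (u ++ [d]).length with hn
  have hnu : n = u.length + 1 := by simp [hn]
  set w := u.reverse ++ [d] with hw
  have hwn : w.length = n := by simp [hw, hnu]
  set sa : ℕ → ℕ := fun k => (suffixArray w).getD k 0
  set L : ℕ → ℕ := fun k => (lcpArray w).getD k 0
  set y : ℕ → ℕ := fun k => n - sa k
  set b : ℕ → α := fun k => (u ++ [d]).getD (y k) d
  have hsa : suffixArray w = (List.range n).map sa := by
    rw [← hwn, ← length_suffixArray]
    exact eq_map_getD_range _ _
  have hL : lcpArray w = (List.range n).map L := by
    rw [← hwn, ← length_lcpArray (by simp [hw])]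
    exact eq_map_getD_range _ _
  have hb : bwt w = (List.range n).map b := by
    rw [bwt_reverse_append_singleton, ← hw, hsa, List.map_map, ← hnu]
    rfl
  have hbij : Set.BijOn sa (Set.Iio n) (Set.Icc 1 n) := hwn ▸ bijOn_getD_suffixArray w
  have hmem (k : ℕ) (hk : k < n) : 1 ≤ sa k ∧ sa k ≤ n := hbij.mapsTo hk
  have hbij_y : Set.BijOn y (Set.Iio n) (Set.Iio n) := by
    refine Set.BijOn.comp (g := fun x => n - x) ⟨fun x hx => ?_, fun x hx x' hx' h => ?_,
      fun x hx => ⟨n - x, ?_, ?_⟩⟩ hbij <;> simp only [Set.mem_Icc, Set.mem_Iio] at * <;> omega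
  refine ⟨b, L, y, ?_, ?_, hbij_y, ?_, ?_, ?_⟩
  · rw [arrays, revText_append_singleton, ← hw, hb, hL, hsa, List.zip_map', List.zip_map']
    refine List.map_congr_left fun k hk => ?_
    have := hmem k (List.mem_range.1 hk)
    simp only [y, Prod.mk.injEq, true_and]
    omega
  · rw [revText_append_singleton, hb]
  · intro k hk
    have hyk : y k < n := hbij_y.mapsTo hk
    rw [List.getElem?_eq_getElem hyk, ← List.getD_eq_getElem _ d]
  · rfl
  · intro k k' hkk' hk' l
    simp only [y, hnu]
    exact forall_le_getD_lcpArray_iff_commonSuffix hd hkk' (hnu ▸ hk') l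

end Arrays

section Eval

variable {σ : ℕ}

attribute [ext] OnePassState

/-- The effect of `eval(l)` on one entry of the table. -/
def evalEntry (l : ℤ) (r : Candidate) : Candidate :=
  if l < r.len then ⟨l, 0, false⟩ else r

/-- The procedure `eval` with a threshold `ls c` of its own for each character `c`. -/
def evalAt (ls : Fin σ → ℤ) (st : OnePassState σ) : OnePassState σ where
  S := st.S ∪ (Finset.univ.filter
    fun c => ls c < (st.R c).len ∧ (st.R c).active = true).image fun c => (st.R c).pos
  R c := evalEntry (ls c) (st.R c)
  m := st.m

theorem eval_eq_evalAt (l : ℤ) (st : OnePassState σ) : eval l st = evalAt (fun _ => l) st :=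
  rfl

theorem mem_evalAt_S {ls : Fin σ → ℤ} {st : OnePassState σ} {x : ℕ} :
    x ∈ (evalAt ls st).S ↔
      x ∈ st.S ∨ ∃ c, ls c < (st.R c).len ∧ (st.R c).active = true ∧ (st.R c).pos = x := by
  simp [evalAt, and_assoc]

theorem mem_eval_S {l : ℤ} {st : OnePassState σ} {x : ℕ} :
    x ∈ (eval l st).S ↔
      x ∈ st.S ∨ ∃ c, l < (st.R c).len ∧ (st.R c).active = true ∧ (st.R c).pos = x :=
  mem_evalAt_S

theorem evalEntry_evalEntry (l l' : ℤ) (r : Candidate) :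
    evalEntry l (evalEntry l' r) = evalEntry (min l' l) r := by
  unfold evalEntry
  grind

theorem evaluated_or_evaluated_evalEntry_iff {l l' : ℤ} {r : Candidate} {x : ℕ} :
    (l' < r.len ∧ r.active = true ∧ r.pos = x ∨ l < (evalEntry l' r).len ∧
      (evalEntry l' r).active = true ∧ (evalEntry l' r).pos = x) ↔
      min l' l < r.len ∧ r.active = true ∧ r.pos = x := by
  unfold evalEntry
  grind

theorem evalAt_evalAt (ls ls' : Fin σ → ℤ) (st : OnePassState σ) :
    evalAt ls (evalAt ls' st) = evalAt (fun c => min (ls' c) (ls c)) st := by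
  ext1
  · ext x
    rw [mem_evalAt_S, mem_evalAt_S, mem_evalAt_S, or_assoc, ← exists_or]
    exact or_congr_right (exists_congr fun c => evaluated_or_evaluated_evalEntry_iff)
  · exact funext fun c => evalEntry_evalEntry _ _ _
  · rfl

theorem eval_eval (l l' : ℤ) (st : OnePassState σ) :
    eval l (eval l' st) = eval (min l' l) st :=
  evalAt_evalAt _ _ st

theorem activate_R (l x : ℕ) (c c' : Fin σ) (st : OnePassState σ) :
    (activate l x c st).R c' =
      if c' = c ∧ (st.R c).len < (l : ℤ) then ⟨l, x, true⟩ else st.R c' := by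
  unfold activate
  by_cases h : (st.R c).len < (l : ℤ) <;> by_cases hc : c' = c <;> simp [h, hc]

theorem activate_S (l x : ℕ) (c : Fin σ) (st : OnePassState σ) :
    (activate l x c st).S = st.S := by
  unfold activate
  split_ifs <;> rfl

theorem activate_with_m (l x : ℕ) (c : Fin σ) (st : OnePassState σ) (m : Option ℕ) :
    activate l x c { st with m := m } = { activate l x c st with m := m } := by
  unfold activate
  dsimp only
  split_ifs <;> rfl

end Eval

section Eager

variable {σ : ℕ}

/-- The body of the main loop for the index `i` of the arrays `b`, `L`, `y`, except that `eval` is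
called in every iteration instead of accumulating the minimum `m` up to the next run boundary. -/
def eagerStep (b : ℕ → Fin σ) (L y : ℕ → ℕ) (i : ℕ) (st : OnePassState σ) : OnePassState σ :=
  if b i ≠ b (i - 1) then
    activate (L i) (y i + 1) (b i) (activate (L i) (y (i - 1) + 1) (b (i - 1)) (eval (L i) st))
  else eval (L i) st

/-- The state of the eager algorithm after the iteration for the index `i`. -/
def eagerState (b : ℕ → Fin σ) (L y : ℕ → ℕ) : ℕ → OnePassState σ
  | 0 => onePassInit σ
  | i + 1 => eagerStep b L y (i + 1) (eagerState b L y i)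

/-- The state in which the evaluation delayed by the accumulator `m` has been performed. -/
def settle (st : OnePassState σ) : OnePassState σ :=
  match st.m with
  | none => st
  | some k => { eval k st with m := none }

theorem eval_min_eq_eval_settle (l : ℕ) (st : OnePassState σ) :
    { eval ((match st.m with | none => l | some k => min k l : ℕ) : ℤ) st with m := none } =
      eval l (settle st) := by
  obtain ⟨S, R, _ | k⟩ := st
  · rfl
  · have h := eval_eval l k ⟨S, R, none⟩
    rw [← Nat.cast_min] at h
    exact h.symm

theorem eval_neg_one_settle_S (st : OnePassState σ) :
    (eval (-1) (settle st)).S = (eval (-1) st).S := by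
  obtain ⟨S, R, _ | k⟩ := st
  · rfl
  · have h := eval_eval (-1) k ⟨S, R, some k⟩
    rw [min_eq_right (by omega)] at h
    exact congrArg (·.S) h

variable {T : List (Fin σ)} {b : ℕ → Fin σ} {L y : ℕ → ℕ}

theorem settle_onePassStep {n i : ℕ} (hi : y i < n) (hi' : y (i + 1) < n) (st : OnePassState σ) :
    settle (onePassStep n st ((b i, L i, n - y i), (b (i + 1), L (i + 1), n - y (i + 1)))) =
      eagerStep b L y (i + 1) (settle st) := by
  have hpos {k : ℕ} (hk : k < n) : n - (n - k) + 1 = k + 1 := by omega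
  simp only [onePassStep, eagerStep, Nat.add_sub_cancel, hpos hi, hpos hi',
    ← eval_min_eq_eval_settle]
  split_ifs
  · simp only [activate_with_m]
    rfl
  · rfl

theorem zip_tail_map_range {α : Type*} (f : ℕ → α) (n : ℕ) :
    ((List.range n).map f).zip ((List.range n).map f).tail =
      (List.range (n - 1)).map fun i => (f i, f (i + 1)) :=
  List.ext_getElem (by simp) fun i _ _ => by simp

theorem settle_foldl_onePassStep {n : ℕ} (hy : ∀ k < n, y k < n) (i : ℕ) (hi : i < n) :
    settle (((List.range i).map fun k =>
      ((b k, L k, n - y k), (b (k + 1), L (k + 1), n - y (k + 1)))).foldl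
        (onePassStep n) (onePassInit σ)) = eagerState b L y i := by
  induction i with
  | zero => rfl
  | succ i ih =>
    rw [List.range_succ, List.map_append, List.foldl_append, List.map_singleton, List.foldl_cons,
      List.foldl_nil, settle_onePassStep (hy i (by omega)) (hy _ hi), ih (by omega), eagerState]

theorem onePass_eq_eager (h : IsArrays T b L y) :
    onePass T = (eval (-1) (eagerState b L y (T.length - 1))).S := by
  rw [onePass, h.arrays_eq, zip_tail_map_range, ← eval_neg_one_settle_S]
  rcases Nat.eq_zero_or_pos T.length with hT | hT
  · simp only [hT]
    rfl
  · rw [settle_foldl_onePassStep (fun k hk => h.bijOn.mapsTo hk) _ (by omega)]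

end Eager

/-! ### Candidates -/

section Candidates

variable {α : Type*} {b : ℕ → α} {L y : ℕ → ℕ} {c : α} {i j j' k k' l m n : ℕ}

/-- The indices `j - 1` and `j` form a run boundary of `b`, and `k` is the one of them that carries
the character `c`: this is the candidate `(j, k)` of `c`, whose level is `L j`. -/
def IsCandidate (b : ℕ → α) (c : α) (j k : ℕ) : Prop :=
  0 < j ∧ b j ≠ b (j - 1) ∧ (k = j ∨ k + 1 = j) ∧ b k = c

/-- No earlier candidate of `c` is linked to the index `j` at the level `L j`. -/
def IsFirst (b : ℕ → α) (L : ℕ → ℕ) (c : α) (j : ℕ) : Prop :=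
  ∀ j' < j, ∀ k', IsCandidate b c j' k' → ¬ ∀ t ∈ Set.Icc j' j, L j ≤ L t

/-- Among the candidates of `c` of index at most `m`, the candidate `(j, k)` is the pending choice
when the levels up to the index `i` are known. -/
structure IsPending (b : ℕ → α) (L : ℕ → ℕ) (m i : ℕ) (c : α) (j k : ℕ) : Prop where
  cand : IsCandidate b c j k
  le : j ≤ m
  first : IsFirst b L c j
  le_level : ∀ t ∈ Set.Icc j i, L j ≤ L t
  max : ∀ j' k', j < j' → j' ≤ m → IsCandidate b c j' k' → L j' ≤ L j

/-- The candidate `(j, k)` of `c` has been definitely chosen by the index `i`: it was pending until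
the level dropped below its own. -/
def IsClosed (b : ℕ → α) (L : ℕ → ℕ) (i : ℕ) (c : α) (j k : ℕ) : Prop :=
  ∃ t < i, IsPending b L t t c j k ∧ L (t + 1) < L j

/-- Among the candidates of `c` of index below `n` that are linked to `(j, k)` at the level `L j`,
the candidate `(j, k)` is the first one of largest level. -/
structure IsSelected (b : ℕ → α) (L : ℕ → ℕ) (n : ℕ) (c : α) (j k : ℕ) : Prop where
  cand : IsCandidate b c j k
  lt : j < n
  first : IsFirst b L c j
  max : ∀ j' k', j < j' → j' < n → IsCandidate b c j' k' → (∀ t ∈ Set.Icc j j', L j ≤ L t) →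
    L j' ≤ L j

theorem IsCandidate.index_unique (h : IsCandidate b c j k) (h' : IsCandidate b c j k') :
    k = k' := by
  obtain ⟨h0, hne, rfl | hk, rfl⟩ := h <;> obtain ⟨-, -, rfl | hk', hc⟩ := h'
  · rfl
  · exact absurd (by rw [← hc, ← hk', Nat.add_sub_cancel]) hne
  · exact absurd (by rw [hc, ← hk, Nat.add_sub_cancel]) hne
  · omega

theorem forall_Icc_succ_iff (hj : j ≤ i + 1) :
    (∀ t ∈ Set.Icc j (i + 1), l ≤ L t) ↔ (∀ t ∈ Set.Icc j i, l ≤ L t) ∧ l ≤ L (i + 1) := by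
  rw [← Set.insert_Icc_right_eq_Icc_add_one hj, Set.forall_mem_insert, and_comm]

/-- The entry `r` of the character `c` when the candidates of index at most `m` have been entered
and the levels up to the index `i` have been evaluated. -/
structure EntryInv (b : ℕ → α) (L y : ℕ → ℕ) (c : α) (m i : ℕ) (r : Candidate) : Prop where
  le_len_iff : ∀ l : ℕ, (l : ℤ) ≤ r.len ↔
    ∃ j k, IsCandidate b c j k ∧ j ≤ m ∧ ∀ t ∈ Set.Icc j i, l ≤ L t
  eq_active_iff : ∀ (l : ℤ) (x : ℕ), r = ⟨l, x, true⟩ ↔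
    ∃ j k, IsPending b L m i c j k ∧ (L j : ℤ) = l ∧ y k + 1 = x

namespace EntryInv

variable {r : Candidate}

theorem initial : EntryInv b L y c 0 0 ⟨-1, 0, false⟩ where
  le_len_iff l := by
    refine iff_of_false (by dsimp only; omega) ?_
    rintro ⟨j, k, ⟨h0, -⟩, hj, -⟩
    omega
  eq_active_iff l x := by
    refine iff_of_false (by simp) ?_
    rintro ⟨j, k, hp, -⟩
    have := hp.cand.1
    have := hp.le
    omega

theorem evaluated_iff (h : EntryInv b L y c m i r) (l : ℤ) (x : ℕ) :
    l < r.len ∧ r.active = true ∧ r.pos = x ↔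
      ∃ j k, IsPending b L m i c j k ∧ l < L j ∧ y k + 1 = x := by
  constructor
  · rintro ⟨hlen, hact, hpos⟩
    obtain ⟨j, k, hp, hj, hk⟩ :=
      (h.eq_active_iff r.len x).1 (by rw [← hact, ← hpos])
    exact ⟨j, k, hp, hj ▸ hlen, hk⟩
  · rintro ⟨j, k, hp, hl, hk⟩
    rw [(h.eq_active_iff (L j) x).2 ⟨j, k, hp, rfl, hk⟩]
    exact ⟨hl, rfl, rfl⟩

theorem evalEntry_len (l : ℤ) (r : Candidate) : (evalEntry l r).len = min r.len l := by
  unfold evalEntry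
  grind

theorem evalEntry_eq_active_iff {l l' : ℤ} {x : ℕ} :
    evalEntry l r = ⟨l', x, true⟩ ↔ r = ⟨l', x, true⟩ ∧ l' ≤ l := by
  unfold evalEntry
  grind

theorem evaluate (h : EntryInv b L y c i i r) :
    EntryInv b L y c i (i + 1) (evalEntry (L (i + 1)) r) where
  le_len_iff l := by
    rw [evalEntry_len, le_min_iff, h.le_len_iff, Nat.cast_le]
    constructor
    · rintro ⟨⟨j, k, hc, hj, hl⟩, hl'⟩
      exact ⟨j, k, hc, hj, (forall_Icc_succ_iff (by omega)).2 ⟨hl, hl'⟩⟩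
    · rintro ⟨j, k, hc, hj, hl⟩
      rw [forall_Icc_succ_iff (by omega)] at hl
      exact ⟨⟨j, k, hc, hj, hl.1⟩, hl.2⟩
  eq_active_iff l x := by
    rw [evalEntry_eq_active_iff, h.eq_active_iff]
    constructor
    · rintro ⟨⟨j, k, hp, rfl, rfl⟩, hl⟩
      have hj := hp.le
      have hlevel := (forall_Icc_succ_iff (by omega)).2 ⟨hp.le_level, Nat.cast_le.1 hl⟩
      exact ⟨j, k, { hp with le_level := hlevel }, rfl, rfl⟩
    · rintro ⟨j, k, hp, rfl, rfl⟩
      have hj := hp.le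
      have hl := (forall_Icc_succ_iff (by omega)).1 hp.le_level
      exact ⟨⟨j, k, { hp with le_level := hl.1 }, rfl, rfl⟩, Nat.cast_le.2 hl.2⟩

theorem skip (h : EntryInv b L y c m i r) (hc : ∀ k, ¬ IsCandidate b c (m + 1) k) :
    EntryInv b L y c (m + 1) i r := by
  have hle {j k} (hj : IsCandidate b c j k) : j ≤ m + 1 ↔ j ≤ m :=
    ⟨fun h => Nat.lt_succ_iff.1 (h.lt_of_ne fun hjm => hc k (hjm ▸ hj)), fun h => h.trans m.le_succ⟩
  refine ⟨fun l => ?_, fun l x => ?_⟩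
  · rw [h.le_len_iff]
    exact exists₂_congr fun j k => and_congr_right fun hj => by rw [hle hj]
  · rw [h.eq_active_iff]
    refine exists₂_congr fun j k => and_congr_left fun _ => ⟨fun hp => ?_, fun hp => ?_⟩
    · exact ⟨hp.cand, (hle hp.cand).2 hp.le, hp.first, hp.le_level,
        fun j' k' hj hm hk' => hp.max j' k' hj ((hle hk').1 hm) hk'⟩
    · exact ⟨hp.cand, (hle hp.cand).1 hp.le, hp.first, hp.le_level,
        fun j' k' hj hm hk' => hp.max j' k' hj ((hle hk').2 hm) hk'⟩

theorem le_len_iff_of_isCandidate (h : EntryInv b L y c i (i + 1) r)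
    (hc : IsCandidate b c (i + 1) k) :
    ((l : ℤ) ≤ r.len ∨ l ≤ L (i + 1)) ↔
      ∃ j k, IsCandidate b c j k ∧ j ≤ i + 1 ∧ ∀ t ∈ Set.Icc j (i + 1), l ≤ L t := by
  rw [h.le_len_iff]
  constructor
  · rintro (⟨j, k, hj, hji, hl⟩ | hl)
    · exact ⟨j, k, hj, by omega, hl⟩
    · exact ⟨i + 1, k, hc, le_rfl, by simpa using hl⟩
  · rintro ⟨j, k, -, hji, hl⟩
    exact Or.inr (hl (i + 1) ⟨hji, le_rfl⟩)

theorem isPending_of_len_lt (h : EntryInv b L y c i (i + 1) r) (hc : IsCandidate b c (i + 1) k)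
    (hlt : r.len < L (i + 1)) : IsPending b L (i + 1) (i + 1) c (i + 1) k where
  cand := hc
  le := le_rfl
  first j hj k' hc' hl :=
    hlt.not_ge ((h.le_len_iff _).2 ⟨j, k', hc', Nat.lt_succ_iff.1 hj, hl⟩)
  le_level t ht := by rw [Set.Icc_self, Set.mem_singleton_iff] at ht; rw [ht]
  max j' k' hj hj' := absurd hj' hj.not_ge

theorem raise (h : EntryInv b L y c i (i + 1) r) (hc : IsCandidate b c (i + 1) k)
    (hlt : r.len < L (i + 1)) :
    EntryInv b L y c (i + 1) (i + 1) ⟨L (i + 1), y k + 1, true⟩ where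
  le_len_iff l := by
    rw [← h.le_len_iff_of_isCandidate hc]
    dsimp only
    omega
  eq_active_iff l x := by
    constructor
    · rintro ⟨rfl, rfl, -⟩
      exact ⟨i + 1, k, h.isPending_of_len_lt hc hlt, rfl, rfl⟩
    · rintro ⟨j, k', hp, rfl, rfl⟩
      rcases hp.le.eq_or_lt with rfl | hj
      · rw [hc.index_unique hp.cand]
      · have hLj := hp.max _ _ hj le_rfl hc
        have hlen := (h.le_len_iff (L j)).2 ⟨j, k', hp.cand, Nat.lt_succ_iff.1 hj, hp.le_level⟩
        omega

theorem keep (h : EntryInv b L y c i (i + 1) r) (hc : IsCandidate b c (i + 1) k)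
    (hle : L (i + 1) ≤ r.len) : EntryInv b L y c (i + 1) (i + 1) r where
  le_len_iff l := by
    rw [← h.le_len_iff_of_isCandidate hc]
    omega
  eq_active_iff l x := by
    constructor
    · intro hr
      obtain ⟨j, k', hp, rfl, rfl⟩ := (h.eq_active_iff l x).1 hr
      rw [hr, Nat.cast_le] at hle
      refine ⟨j, k', ⟨hp.cand, hp.le.trans i.le_succ, hp.first, hp.le_level,
        fun j' k'' hj hj' hc' => ?_⟩, rfl, rfl⟩
      rcases hj'.eq_or_lt with rfl | hj'
      exacts [hle, hp.max j' k'' hj (Nat.lt_succ_iff.1 hj') hc']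
    · rintro ⟨j, k', hp, rfl, rfl⟩
      refine (h.eq_active_iff _ _).2 ⟨j, k', ⟨hp.cand, ?_, hp.first, hp.le_level,
        fun j' k'' hj hj' => hp.max j' k'' hj (hj'.trans i.le_succ)⟩, rfl, rfl⟩
      by_contra hj
      obtain rfl : j = i + 1 := le_antisymm hp.le (by omega)
      obtain ⟨j', k'', hc', hj', hl⟩ := (h.le_len_iff _).1 hle
      exact hp.first j' (by omega) k'' hc' hl

end EntryInv
end Candidates

section Table

variable {σ : ℕ} {b : ℕ → Fin σ} {L y : ℕ → ℕ} {c : Fin σ} {i k : ℕ}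

theorem eagerStep_R_of_isCandidate (st : OnePassState σ) (h : IsCandidate b c i k) :
    (eagerStep b L y i st).R c =
      if (evalEntry (L i) (st.R c)).len < (L i : ℤ) then ⟨L i, y k + 1, true⟩
      else evalEntry (L i) (st.R c) := by
  obtain ⟨-, hne, rfl | rfl, rfl⟩ := h
  · rw [eagerStep, if_pos hne]
    simp only [activate_R, hne, false_and, if_false, true_and]
    rfl
  · rw [Nat.add_sub_cancel] at hne
    rw [eagerStep, Nat.add_sub_cancel, if_pos hne]
    simp only [activate_R, hne.symm, false_and, if_false, true_and]
    rfl

theorem eagerStep_R_of_not_isCandidate (st : OnePassState σ) (hi : 0 < i)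
    (h : ∀ k, ¬ IsCandidate b c i k) :
    (eagerStep b L y i st).R c = evalEntry (L i) (st.R c) := by
  rw [eagerStep]
  split_ifs with hne
  · have hi_ne : c ≠ b i := fun hc => h i ⟨hi, hne, Or.inl rfl, hc.symm⟩
    have hpred_ne : c ≠ b (i - 1) :=
      fun hc => h (i - 1) ⟨hi, hne, Or.inr (by omega), hc.symm⟩
    simp only [activate_R, hi_ne, hpred_ne, false_and, if_false]
    rfl
  · rfl

theorem eagerStep_S (i : ℕ) (st : OnePassState σ) :
    (eagerStep b L y i st).S = (eval (L i) st).S := by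
  rw [eagerStep]
  split_ifs <;> simp only [activate_S]

theorem EntryInv.eagerStep {st : OnePassState σ} (h : EntryInv b L y c i i (st.R c)) :
    EntryInv b L y c (i + 1) (i + 1) ((eagerStep b L y (i + 1) st).R c) := by
  by_cases hc : ∃ k, IsCandidate b c (i + 1) k
  · obtain ⟨k, hk⟩ := hc
    rw [eagerStep_R_of_isCandidate st hk]
    split_ifs with hlt
    exacts [h.evaluate.raise hk hlt, h.evaluate.keep hk (not_lt.1 hlt)]
  · rw [eagerStep_R_of_not_isCandidate st i.succ_pos (not_exists.1 hc)]
    exact h.evaluate.skip (not_exists.1 hc)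

theorem entryInv_eagerState (c : Fin σ) (i : ℕ) :
    EntryInv b L y c i i ((eagerState b L y i).R c) := by
  induction i with
  | zero => exact .initial
  | succ i ih => exact ih.eagerStep

theorem mem_eval_eagerState_iff_isPending {l : ℤ} {x : ℕ} :
    x ∈ (eval l (eagerState b L y i)).S ↔ x ∈ (eagerState b L y i).S ∨
      ∃ c j k, IsPending b L i i c j k ∧ l < L j ∧ y k + 1 = x := by
  rw [mem_eval_S]
  exact or_congr_right (exists_congr fun c => (entryInv_eagerState c i).evaluated_iff l x)

theorem mem_eagerState_S {x : ℕ} :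
    x ∈ (eagerState b L y i).S ↔ ∃ c j k, IsClosed b L i c j k ∧ y k + 1 = x := by
  induction i with
  | zero => simp [eagerState, onePassInit, IsClosed]
  | succ i ih =>
    rw [eagerState, eagerStep_S, mem_eval_eagerState_iff_isPending, ih]
    constructor
    · rintro (⟨c, j, k, ⟨t, ht, hp, hlt⟩, hx⟩ | ⟨c, j, k, hp, hlt, hx⟩)
      · exact ⟨c, j, k, ⟨t, by omega, hp, hlt⟩, hx⟩
      · exact ⟨c, j, k, ⟨i, i.lt_succ_self, hp, Nat.cast_lt.1 hlt⟩, hx⟩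
    · rintro ⟨c, j, k, ⟨t, ht, hp, hlt⟩, hx⟩
      rcases (Nat.lt_succ_iff.1 ht).eq_or_lt with rfl | ht
      · exact Or.inr ⟨c, j, k, hp, Nat.cast_lt.2 hlt, hx⟩
      · exact Or.inl ⟨c, j, k, ⟨t, ht, hp, hlt⟩, hx⟩

theorem notMem_eval_eagerState_S {n : ℕ} (hy : Set.InjOn y (Set.Iio n)) (hi : i + 1 < n)
    (hc : IsCandidate b c (i + 1) k)
    (hlen : (evalEntry (L (i + 1)) ((eagerState b L y i).R c)).len < (L (i + 1) : ℤ)) :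
    y k + 1 ∉ (eval (L (i + 1)) (eagerState b L y i)).S := by
  rw [← eagerStep_S (b := b) (y := y), ← eagerState, mem_eagerState_S]
  rintro ⟨c', j, k', ⟨t, ht, hp, hlt⟩, hx⟩
  have hjt := hp.le
  have hkj := hp.cand.2.2.1
  have hki := hc.2.2.1
  obtain rfl : k' = k := hy (by simp; omega) (by simp; omega) (Nat.succ_injective hx)
  obtain rfl : c' = c := hp.cand.2.2.2.symm.trans hc.2.2.2
  obtain rfl : j = i := by omega
  obtain rfl : t = j := by omega
  have hlink : (L (t + 1) : ℤ) ≤ ((eagerState b L y t).R c').len :=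
    ((entryInv_eagerState c' t).le_len_iff _).2 ⟨t, k', hp.cand, le_rfl, by simpa using hlt.le⟩
  rw [EntryInv.evalEntry_len] at hlen
  omega

end Table

section Selected

variable {α : Type*} {b : ℕ → α} {L : ℕ → ℕ} {c : α} {j k n : ℕ}

theorem IsPending.isSelected (h : IsPending b L (n - 1) (n - 1) c j k) (hn : 0 < n) :
    IsSelected b L n c j k :=
  ⟨h.cand, h.le.trans_lt (by omega), h.first,
    fun j' k' hj hn hc _ => h.max j' k' hj (by omega) hc⟩

theorem IsClosed.isSelected (h : IsClosed b L (n - 1) c j k) : IsSelected b L n c j k := by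
  obtain ⟨t, ht, hp, hlt⟩ := h
  have hj := hp.le
  refine ⟨hp.cand, by omega, hp.first, fun j' k' hjj' _ hc hl => ?_⟩
  rcases Nat.lt_or_ge t j' with htj' | htj'
  · exact absurd (hl (t + 1) ⟨by omega, htj'⟩) hlt.not_ge
  · exact hp.max j' k' hjj' htj' hc

theorem IsSelected.isPending (h : IsSelected b L n c j k) {i : ℕ} (hj : j ≤ i) (hi : i < n)
    (hl : ∀ t ∈ Set.Icc j i, L j ≤ L t) : IsPending b L i i c j k :=
  ⟨h.cand, hj, h.first, hl, fun j' k' hjj' hj' hc =>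
    h.max j' k' hjj' (hj'.trans_lt hi) hc fun t ht => hl t ⟨ht.1, ht.2.trans hj'⟩⟩

theorem isSelected_iff (hn : 0 < n) :
    IsSelected b L n c j k ↔ IsPending b L (n - 1) (n - 1) c j k ∨ IsClosed b L (n - 1) c j k := by
  classical
  refine ⟨fun h => ?_, fun h => h.elim (·.isSelected hn) (·.isSelected)⟩
  have hj := h.lt
  by_cases hdrop : ∃ t, t ∈ Set.Icc j (n - 1) ∧ L t < L j
  · obtain ⟨⟨hjt, htn⟩, hlt⟩ := Nat.find_spec hdrop
    have hmin := fun t => Nat.find_min (m := t) hdrop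
    generalize Nat.find hdrop = t at hjt htn hlt hmin
    have hne : j ≠ t := by
      rintro rfl
      exact hlt.false
    refine Or.inr ⟨t - 1, by omega, h.isPending (by omega) (by omega) fun t' ht' => ?_, ?_⟩
    · simp only [Set.mem_Icc] at hmin ht'
      by_contra! hlt'
      exact hmin t' (by omega) ⟨by omega, hlt'⟩
    · rwa [Nat.sub_add_cancel (by omega)]
  · push Not at hdrop
    exact Or.inl (h.isPending (by omega) (by omega) hdrop)

theorem mem_eval_eagerState_iff_isSelected {σ : ℕ} {b : ℕ → Fin σ} {y : ℕ → ℕ} (hn : 0 < n)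
    {x : ℕ} : x ∈ (eval (-1) (eagerState b L y (n - 1))).S ↔
      ∃ c j k, IsSelected b L n c j k ∧ y k + 1 = x := by
  have hneg (j : ℕ) : (-1 : ℤ) < L j := by omega
  simp only [mem_eval_eagerState_iff_isPending, mem_eagerState_S, isSelected_iff hn, hneg,
    true_and, or_and_right, exists_or]
  exact or_comm

end Selected

/-! ### Smallest suffixient sets -/

section Links

variable {α : Type*} {b : ℕ → α} {L : ℕ → ℕ} {c : α} {j j' k k' k'' l n : ℕ}

/-- The suffixes of ranks `k` and `k'` agree on their first `l` characters, in terms of the LCP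
array `L`. -/
def Linked (L : ℕ → ℕ) (l k k' : ℕ) : Prop :=
  ∀ t ∈ Set.uIoc k k', l ≤ L t

theorem Linked.symm (h : Linked L l k k') : Linked L l k' k := by
  rwa [Linked, Set.uIoc_comm]

theorem Linked.trans (h : Linked L l k k') (h' : Linked L l k' k'') : Linked L l k k'' := by
  intro t ht
  by_cases htk : t ∈ Set.uIoc k k'
  · exact h t htk
  · refine h' t ?_
    rw [Set.mem_uIoc] at *
    omega

theorem exists_first_max {B : Finset ℕ} (hB : B.Nonempty) (L : ℕ → ℕ) :
    ∃ j ∈ B, ∀ j' ∈ B, L j' ≤ L j ∧ (L j' = L j → j ≤ j') := by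
  obtain ⟨j₁, hj₁, hmax⟩ := B.exists_max_image L hB
  obtain ⟨j, hj, hmin⟩ := (B.filter fun j => L j = L j₁).exists_min_image id
    ⟨j₁, Finset.mem_filter.2 ⟨hj₁, rfl⟩⟩
  obtain ⟨hjB, hjL⟩ := Finset.mem_filter.1 hj
  exact ⟨j, hjB, fun j' hj' => ⟨hjL ▸ hmax j' hj',
    fun hL => hmin j' (Finset.mem_filter.2 ⟨hj', hL.trans hjL⟩)⟩⟩

theorem IsCandidate.exists_isSelected (h : IsCandidate b c j k) (hj : j < n) :
    ∃ j' k', IsSelected b L n c j' k' ∧ ∀ t ∈ Set.uIcc j j', L j ≤ L t := by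
  classical
  let B := (Finset.range n).filter fun j' =>
    (∃ k', IsCandidate b c j' k') ∧ ∀ t ∈ Set.uIcc j j', L j ≤ L t
  have mem_B (j' : ℕ) : j' ∈ B ↔ j' < n ∧ (∃ k', IsCandidate b c j' k') ∧
      ∀ t ∈ Set.uIcc j j', L j ≤ L t := by simp [B]
  obtain ⟨j₁, hj₁, hmax⟩ := exists_first_max ⟨j, (mem_B j).2 ⟨hj, ⟨k, h⟩, by simp⟩⟩ L
  obtain ⟨hj₁n, ⟨k₁, hc₁⟩, hl₁⟩ := (mem_B j₁).1 hj₁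
  have hle : L j ≤ L j₁ := hl₁ j₁ Set.right_mem_uIcc
  have mem_B_of_link {j' k' : ℕ} (hj' : j' < n) (hc' : IsCandidate b c j' k')
      (hl : ∀ t ∈ Set.uIcc j₁ j', L j₁ ≤ L t) : j' ∈ B :=
    (mem_B j').2 ⟨hj', ⟨k', hc'⟩, fun t ht => (Set.uIcc_subset_uIcc_union_uIcc ht).elim (hl₁ t)
      fun ht => hle.trans (hl t ht)⟩
  refine ⟨j₁, k₁, ⟨hc₁, hj₁n, fun j' hj' k' hc' hl => ?_, fun j' k' hj' hn' hc' hl => ?_⟩, hl₁⟩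
  · rw [← Set.uIcc_of_ge hj'.le] at hl
    have hB := hmax j' (mem_B_of_link (hj'.trans hj₁n) hc' hl)
    exact hj'.not_ge (hB.2 (hB.1.antisymm (hl j' Set.right_mem_uIcc)))
  · rw [← Set.uIcc_of_le hj'.le] at hl
    exact (hmax j' (mem_B_of_link hn' hc' hl)).1

theorem IsSelected.not_linked (h : IsSelected b L n c j k) (h' : IsSelected b L n c j' k')
    (hne : k ≠ k') : ¬ Linked L (min (L j) (L j')) k k' := by
  wlog hlt : j < j' generalizing j k j' k'
  · rcases (not_lt.1 hlt).eq_or_lt with rfl | hlt'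
    · exact absurd (h.cand.index_unique h'.cand) hne
    · exact fun hlink => this h' h hne.symm hlt' (min_comm (L j) _ ▸ hlink.symm)
  intro hlink
  have hk := h.cand.2.2.1
  have hk' := h'.cand.2.2.1
  have hlevel : ∀ t ∈ Set.Icc j j', min (L j) (L j') ≤ L t := by
    intro t ⟨hjt, htj'⟩
    rcases hjt.eq_or_lt with rfl | hjt
    · exact min_le_left _ _
    rcases htj'.eq_or_lt with rfl | htj'
    · exact min_le_right _ _
    · exact hlink t (Set.mem_uIoc.2 (by omega))
  refine h'.first j hlt k h.cand ?_
  rcases le_total (L j) (L j') with hle | hle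
  · rw [min_eq_left hle] at hlevel
    rwa [(h.max j' k' hlt h'.lt h'.cand hlevel).antisymm hle]
  · rwa [min_eq_right hle] at hlevel

theorem exists_change {P : ℕ → Prop} (h : k < k') (hP : ¬ (P k ↔ P k')) :
    ∃ j ∈ Set.Ioc k k', (P (j - 1) ↔ P k) ∧ (P j ↔ P k') := by
  induction k', h using Nat.le_induction with
  | base => exact ⟨k + 1, by simp, by simp⟩
  | succ m hm ih =>
    by_cases hm' : P k ↔ P m
    · exact ⟨m + 1, ⟨by omega, le_rfl⟩, by simp [hm']⟩
    · obtain ⟨j, hj, hjk⟩ := ih hm'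
      refine ⟨j, ⟨hj.1, hj.2.trans m.le_succ⟩, hjk.1, hjk.2.trans ?_⟩
      tauto

theorem Linked.exists_isCandidate (h : Linked L l k k') (hk : k < n) (hk' : k' < n)
    (hb : b k' ≠ b k) : ∃ j i, IsCandidate b (b k) j i ∧ j < n ∧ l ≤ L j ∧ Linked L l k i := by
  have hne : k ≠ k' := fun hkk' => hb (hkk' ▸ rfl)
  rcases hne.lt_or_gt with hlt | hlt
  · obtain ⟨j, hj, hj₁, hj₂⟩ := exists_change (P := (b · = b k)) hlt (by simp [hb])
    simp only [iff_true, hb, iff_false] at hj₁ hj₂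
    obtain ⟨hkj, hjk'⟩ := hj
    refine ⟨j, j - 1, ⟨by omega, hj₁ ▸ hj₂, Or.inr (by omega), hj₁⟩, by omega,
      h j (Set.mem_uIoc.2 (by omega)), fun t ht => h t ?_⟩
    rw [Set.mem_uIoc] at *
    omega
  · obtain ⟨j, hj, hj₁, hj₂⟩ := exists_change (P := (b · = b k)) hlt (by simp [hb])
    simp only [iff_true, hb, iff_false] at hj₁ hj₂
    obtain ⟨hkj, hjk'⟩ := hj
    refine ⟨j, j, ⟨by omega, hj₂ ▸ Ne.symm hj₁, Or.inl rfl, hj₂⟩, by omega,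
      h j (Set.mem_uIoc.2 (by omega)), fun t ht => h t ?_⟩
    rw [Set.mem_uIoc] at *
    omega

theorem IsCandidate.exists_linked_ne (h : IsCandidate b c j k) (hj : j < n) :
    ∃ k' < n, b k' ≠ c ∧ Linked L (L j) k k' := by
  obtain ⟨hj0, hne, rfl | rfl, rfl⟩ := h
  · refine ⟨k - 1, by omega, hne.symm, fun t ht => ?_⟩
    rw [Set.uIoc_of_ge (by omega), Set.mem_Ioc] at ht
    rw [show t = k by omega]
  · refine ⟨k + 1, hj, hne, fun t ht => ?_⟩
    rw [Set.uIoc_of_le (by omega), Set.mem_Ioc] at ht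
    rw [show t = k + 1 by omega]

theorem IsCandidate.index_lt (h : IsCandidate b c j k) (hj : j < n) : k < n := by
  have := h.2.2.1
  omega

end Links

section Extensions

variable {α : Type*} {T : List α} {c : α} {l y z : ℕ}

/-- The last character of `T` occurs nowhere else in `T`, and `T` has at least two characters. -/
def IsTerminated (T : List α) : Prop :=
  2 ≤ T.length ∧ ∃ u d, T = u ++ [d] ∧ d ∉ u

theorem take_succ_of_getElem? (h : T[y]? = some c) : T.take (y + 1) = T.take y ++ [c] := by
  rw [List.take_add_one, h, Option.toList_some]

theorem lt_length_of_getElem? (h : T[y]? = some c) : y < T.length :=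
  (List.getElem?_eq_some_iff.1 h).1

theorem drop_take_succ_of_getElem? (h : T[y]? = some c) (l : ℕ) :
    (T.take (y + 1)).drop (y - l) = (T.take y).drop (y - l) ++ [c] := by
  have := lt_length_of_getElem? h
  rw [take_succ_of_getElem? h, List.drop_append_of_le_length (by simp; omega)]

theorem CommonSuffix.isSuffix (h : CommonSuffix T l y z) (hy : T[y]? = some c)
    (hz : T[z]? = some c) : (T.take (y + 1)).drop (y - l) <:+ T.take (z + 1) := by
  rw [drop_take_succ_of_getElem? hy, h.2.2, ← drop_take_succ_of_getElem? hz]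
  exact List.drop_suffix _ _

theorem commonSuffix_of_isSuffix (hl : l ≤ y) (hy : T[y]? = some c) (hz : z < T.length)
    (h : (T.take (y + 1)).drop (y - l) <:+ T.take (z + 1)) :
    CommonSuffix T l y z ∧ T[z]? = some c := by
  have hy' := lt_length_of_getElem? hy
  have hz' : T[z]? = some T[z] := List.getElem?_eq_getElem hz
  obtain ⟨pre, hpre⟩ := h
  rw [drop_take_succ_of_getElem? hy, take_succ_of_getElem? hz', ← List.append_assoc] at hpre
  obtain ⟨hinit, hlast⟩ := List.append_inj' hpre rfl
  have hlen := congrArg List.length hinit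
  simp only [List.length_append, List.length_drop, List.length_take, min_eq_left hy'.le,
    min_eq_left hz.le] at hlen
  refine ⟨⟨hl, by omega, ?_⟩, by rw [hz', ← List.singleton_injective hlast]⟩
  rw [← hinit, List.drop_left' (by omega)]

theorem exists_getElem?_of_isInfix {β : List α} (h : (β ++ [c]) <:+: T) :
    ∃ y, T[y]? = some c ∧ β.length ≤ y ∧ (T.take y).drop (y - β.length) = β := by
  obtain ⟨pre, post, rfl⟩ := h
  refine ⟨(pre ++ β).length, ?_, by simp, ?_⟩
  · rw [← List.append_assoc, List.append_assoc _ [c], List.getElem?_append_right le_rfl]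
    simp
  · rw [← List.append_assoc, List.append_assoc _ [c], List.take_left]
    simp

theorem isInfix_of_getElem? (h : T[y]? = some c) (l : ℕ) :
    ((T.take y).drop (y - l) ++ [c]) <:+: T := by
  rw [← drop_take_succ_of_getElem? h]
  exact (List.drop_suffix _ _).isInfix.trans (List.take_prefix _ _).isInfix

/-- A suffix of the text ends in the end marker, which cannot precede any other character. -/
theorem IsTerminated.eq_zero_of_isSuffix (hT : IsTerminated T) (hl : l ≤ y) (hy : y < T.length)
    (h : (T.take y).drop (y - l) <:+ T) : l = 0 := by
  obtain ⟨-, u, d, rfl, hd⟩ := hT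
  simp only [List.length_append, List.length_singleton] at hy
  rw [List.take_append_of_le_length (by omega)] at h
  by_contra hl0
  have hne : (u.take y).drop (y - l) ≠ [] := List.ne_nil_of_length_pos (by simp; omega)
  have hlast : ((u.take y).drop (y - l)).getLast hne = d := by
    simpa using h.getLast hne
  exact hd (hlast ▸ List.mem_of_mem_take (List.mem_of_mem_drop (List.getLast_mem hne)))

theorem IsTerminated.exists_getElem?_ne (hT : IsTerminated T) (c : α) :
    ∃ (z : ℕ) (c' : α), T[z]? = some c' ∧ c' ≠ c := by
  obtain ⟨hlen, u, d, rfl, hd⟩ := hT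
  by_cases hc : d = c
  · have hu : 0 < u.length := by
      simp only [List.length_append, List.length_singleton] at hlen
      omega
    refine ⟨0, u[0], by rw [List.getElem?_append_left hu, List.getElem?_eq_getElem hu], ?_⟩
    rintro rfl
    exact hd (hc ▸ List.getElem_mem hu)
  · exact ⟨u.length, d, by simp, hc⟩

theorem IsTerminated.exists_commonSuffix_ne (hT : IsTerminated T) (hl : l ≤ y)
    (hy : y < T.length) (h : RightMaximal T ((T.take y).drop (y - l))) (c : α) :
    ∃ z c', T[z]? = some c' ∧ c' ≠ c ∧ CommonSuffix T l y z := by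
  rcases h with h | ⟨a, a', hne, ha, ha'⟩
  · obtain rfl := hT.eq_zero_of_isSuffix hl hy h
    obtain ⟨z, c', hz, hc'⟩ := hT.exists_getElem?_ne c
    exact ⟨z, c', hz, hc', y.zero_le, z.zero_le, by simp⟩
  · obtain ⟨c', hc', hsubstring⟩ : ∃ c', c' ≠ c ∧ ((T.take y).drop (y - l) ++ [c']) <:+: T := by
      by_cases hac : a = c
      exacts [⟨a', hac ▸ hne.symm, ha'⟩, ⟨a, hac, ha⟩]
    obtain ⟨z, hz, hle, heq⟩ := exists_getElem?_of_isInfix hsubstring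
    rw [show ((T.take y).drop (y - l)).length = l by simp; omega] at hle heq
    exact ⟨z, c', hz, hc', hl, hle, heq.symm⟩

theorem IsSuffixient.exists_commonSuffix {S : Finset ℕ} (hS : IsSuffixient T S)
    (h : CommonSuffix T l y z) {c' : α} (hy : T[y]? = some c) (hz : T[z]? = some c')
    (hne : c ≠ c') : ∃ x, x + 1 ∈ S ∧ T[x]? = some c ∧ CommonSuffix T l y x := by
  have hy' := lt_length_of_getElem? hy
  obtain ⟨x, hx, hsuf⟩ := hS.2 (y - l + 1) (y + 1) (by omega) (by omega) hy'
    (Or.inr ⟨c, c', hne, isInfix_of_getElem? hy l, h.2.2 ▸ isInfix_of_getElem? hz l⟩)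
  have hmem := Finset.mem_Icc.1 (hS.1 hx)
  obtain ⟨x, rfl⟩ : ∃ x', x = x' + 1 := ⟨x - 1, by omega⟩
  obtain ⟨hcom, hxc⟩ := commonSuffix_of_isSuffix h.1 hy hmem.2 hsuf
  exact ⟨x, hx, hxc, hcom⟩

end Extensions

section Smallest

variable {α : Type*} [LinearOrder α] {T : List α} {b : ℕ → α} {L y : ℕ → ℕ} {S S' : Finset ℕ}

theorem IsArrays.linked_iff (h : IsArrays T b L y) {k k' : ℕ} (hk : k < T.length)
    (hk' : k' < T.length) (hne : k ≠ k') (l : ℕ) :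
    Linked L l k k' ↔ CommonSuffix T l (y k) (y k') := by
  rcases hne.lt_or_gt with hlt | hlt
  · rw [← h.le_lcp_iff k k' hlt hk', Linked, Set.uIoc_of_le hlt.le]
  · rw [Linked, Set.uIoc_of_ge hlt.le, h.le_lcp_iff k' k hlt hk]
    exact ⟨CommonSuffix.symm, CommonSuffix.symm⟩

theorem IsArrays.isSuffixient_of_isSelected (h : IsArrays T b L y) (hT : IsTerminated T)
    (hS : ∀ x, x ∈ S ↔ ∃ c j k, IsSelected b L T.length c j k ∧ y k + 1 = x) :
    IsSuffixient T S := by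
  refine ⟨fun x hx => ?_, fun i j hi hij hj hmax => ?_⟩
  · obtain ⟨c, j, k, hsel, rfl⟩ := (hS x).1 hx
    exact Finset.mem_Icc.2 ⟨by omega, h.bijOn.mapsTo (hsel.cand.index_lt hsel.lt)⟩
  obtain ⟨y₀, rfl⟩ : ∃ y₀, j = y₀ + 1 := ⟨j - 1, by omega⟩
  obtain ⟨l, hl, rfl⟩ : ∃ l, l ≤ y₀ ∧ i = y₀ - l + 1 := ⟨y₀ + 1 - i, by omega, by omega⟩
  simp only [Nat.add_sub_cancel] at hmax ⊢
  obtain ⟨k, hk, rfl⟩ := h.bijOn.surjOn (show y₀ ∈ Set.Iio T.length from hj)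
  obtain ⟨z, c', hz, hc', hcom⟩ := hT.exists_commonSuffix_ne hl hj hmax (b k)
  obtain ⟨k', hk', rfl⟩ := h.bijOn.surjOn (show z ∈ Set.Iio T.length from lt_length_of_getElem? hz)
  have hb : b k' ≠ b k := by
    rwa [← Option.some.inj ((h.getElem?_eq k' hk').symm.trans hz)] at hc'
  have hlink := (h.linked_iff hk hk' (fun hkk' => hb (hkk' ▸ rfl)) l).2 hcom
  obtain ⟨j₁, k₁, hcand, hj₁, hlj₁, hlink₁⟩ := hlink.exists_isCandidate hk hk' hb
  obtain ⟨j₂, k₂, hsel, hlevel⟩ := hcand.exists_isSelected hj₁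
  have hlink₂ : Linked L l k k₂ := hlink₁.trans fun t ht => hlj₁.trans <| hlevel t <| by
    have := hcand.2.2.1
    have := hsel.cand.2.2.1
    rw [Set.mem_uIoc] at ht
    rw [Set.mem_uIcc]
    omega
  have hk₂ := hsel.cand.index_lt hsel.lt
  have hcom₂ : CommonSuffix T l (y k) (y k₂) := by
    rcases eq_or_ne k k₂ with rfl | hne
    exacts [.refl hl, (h.linked_iff hk hk₂ hne l).1 hlink₂]
  exact ⟨_, (hS _).2 ⟨_, _, _, hsel, rfl⟩,
    hcom₂.isSuffix (h.getElem?_eq k hk) (hsel.cand.2.2.2 ▸ h.getElem?_eq k₂ hk₂)⟩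

theorem IsArrays.exists_commonSuffix_of_isSelected (h : IsArrays T b L y) (hS' : IsSuffixient T S')
    {c : α} {j k : ℕ} (hsel : IsSelected b L T.length c j k) :
    ∃ z, z + 1 ∈ S' ∧ T[z]? = some c ∧ CommonSuffix T (L j) (y k) z := by
  obtain ⟨k', hk', hne, hlink⟩ := hsel.cand.exists_linked_ne hsel.lt
  have hk := hsel.cand.index_lt hsel.lt
  have hb : b k = c := hsel.cand.2.2.2
  have hcom := (h.linked_iff hk hk' (fun hkk' => hne (hkk' ▸ hb)) _).1 hlink
  exact hS'.exists_commonSuffix hcom (hb ▸ h.getElem?_eq k hk) (h.getElem?_eq k' hk') hne.symm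

theorem IsArrays.card_le_of_isSelected (h : IsArrays T b L y)
    (hS : ∀ x, x ∈ S ↔ ∃ c j k, IsSelected b L T.length c j k ∧ y k + 1 = x)
    (hS' : IsSuffixient T S') : S.card ≤ S'.card := by
  have hwitness (x : ℕ) (hx : x ∈ S) : ∃ x' c j k z, IsSelected b L T.length c j k ∧ y k + 1 = x ∧
      z + 1 = x' ∧ x' ∈ S' ∧ T[z]? = some c ∧ CommonSuffix T (L j) (y k) z := by
    obtain ⟨c, j, k, hsel, rfl⟩ := (hS x).1 hx
    obtain ⟨z, hz, hzc, hcom⟩ := h.exists_commonSuffix_of_isSelected hS' hsel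
    exact ⟨_, c, j, k, z, hsel, rfl, rfl, hz, hzc, hcom⟩
  have : Nonempty α := ⟨b 0⟩
  choose! f c j k z hsel hyk hzf hmem hzc hcom using hwitness
  refine Finset.card_le_card_of_injOn f hmem fun x hx x' hx' hf => ?_
  rw [Finset.mem_coe] at hx hx'
  have hz : z x = z x' := by
    have := hzf x hx
    have := hzf x' hx'
    omega
  have hc : c x' = c x := Option.some.inj ((hzc x' hx').symm.trans (hz ▸ hzc x hx))
  by_contra hne
  have hk : k x ≠ k x' := fun hk => hne (by rw [← hyk x hx, ← hyk x' hx', hk])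
  refine (hsel x hx).not_linked (hc ▸ hsel x' hx') hk ?_
  rw [h.linked_iff ((hsel x hx).cand.index_lt (hsel x hx).lt)
    ((hsel x' hx').cand.index_lt (hsel x' hx').lt) hk]
  exact ((hcom x hx).mono (min_le_left _ _)).trans
    (hz ▸ ((hcom x' hx').mono (min_le_right _ _)).symm)

theorem IsArrays.isSmallestSuffixient_onePass {σ : ℕ} {T : List (Fin σ)} {b : ℕ → Fin σ}
    {L y : ℕ → ℕ} (h : IsArrays T b L y) (hT : IsTerminated T) :
    IsSmallestSuffixient T (onePass T) := by
  have hS (x : ℕ) : x ∈ onePass T ↔ ∃ c j k, IsSelected b L T.length c j k ∧ y k + 1 = x := by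
    rw [onePass_eq_eager h, mem_eval_eagerState_iff_isSelected (Nat.zero_lt_two.trans_le hT.1)]
  exact ⟨h.isSuffixient_of_isSelected hT hS, fun S' hS' => h.card_le_of_isSelected hS hS'⟩

end Smallest

/-! ### Delayed updates -/

section Lazy

variable {σ : ℕ}

theorem evalAt_of_le {ls : Fin σ → ℤ} {st : OnePassState σ} (h : ∀ c, (st.R c).len ≤ ls c) :
    evalAt ls st = st := by
  ext1
  · ext x
    rw [mem_evalAt_S]
    exact or_iff_left fun ⟨c, hc, _⟩ => (h c).not_gt hc
  · exact funext fun c => if_neg (h c).not_gt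
  · rfl

theorem activate_evalAt {ls : Fin σ → ℤ} {st : OnePassState σ} {c : Fin σ} {l : ℕ} (x : ℕ)
    (hl : (l : ℤ) ≤ ls c) (hc : (st.R c).len ≤ ls c) :
    activate l x c (evalAt ls st) = evalAt ls (activate l x c st) := by
  have hR : (evalAt ls st).R c = st.R c := if_neg hc.not_gt
  ext1
  · ext z
    rw [activate_S, mem_evalAt_S, mem_evalAt_S, activate_S]
    refine or_congr_right (exists_congr fun c' => ?_)
    rw [activate_R]
    grind
  · funext c'
    rw [activate_R, hR]
    simp only [evalAt, activate_R, evalEntry]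
    grind
  · unfold activate
    rw [hR]
    split_ifs <;> rfl

/-- The state of the one-pass algorithm stored as numbers: `len c` and `pos c` are the length plus
one and the position of the entry of `c`, where inactive entries have the position `0`, and `out`
lists the set that has been output. -/
def tableState (len pos : Fin σ → ℕ) (out : List ℕ) : OnePassState σ where
  S := out.toFinset
  R c := ⟨(len c : ℤ) - 1, pos c, decide (0 < pos c)⟩
  m := none

/-- The stored table `len`, `pos` and the output `out` represent the state `st` if the update
`eval(n - e c)` is still to be applied to the entry of each character `c`. Only updates with
`n - e c < n` have an effect, so `e c = 0` stands for no delayed update. -/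
structure Represents (n : ℕ) (len pos e : Fin σ → ℕ) (out : List ℕ) (st : OnePassState σ) :
    Prop where
  e_le : ∀ c, e c ≤ n
  len_le : ∀ c, len c ≤ n
  evalAt_eq : evalAt (fun c => (n : ℤ) - e c) (tableState len pos out) = st
  nodup : out.Nodup
  pos_notMem : ∀ c, 0 < pos c → pos c ∉ out
  pos_inj : ∀ c c', 0 < pos c → pos c = pos c' → c = c'
  len_pos : ∀ c, 0 < pos c → 0 < len c

variable {n : ℕ} {st : OnePassState σ} {len pos e : Fin σ → ℕ} {out : List ℕ} {c : Fin σ}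

theorem represents_init (n : ℕ) :
    Represents n (fun _ => 0) (fun _ => 0) (fun _ => 0) [] (onePassInit σ) where
  e_le _ := n.zero_le
  len_le _ := n.zero_le
  evalAt_eq := evalAt_of_le fun _ => by simp only [tableState]; omega
  nodup := List.nodup_nil
  pos_notMem _ _ := List.not_mem_nil
  pos_inj _ _ hc := absurd hc (lt_irrefl 0)
  len_pos _ hc := absurd hc (lt_irrefl 0)

theorem Represents.eval {l : ℕ} (h : Represents n len pos e out st) (hl : l ≤ n) :
    Represents n len pos (fun c => max (e c) (n - l)) out (eval l st) where
  __ := h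
  e_le c := max_le (h.e_le c) (Nat.sub_le n l)
  evalAt_eq := by
    rw [eval_eq_evalAt, ← h.evalAt_eq, evalAt_evalAt]
    congr 1
    funext c
    push_cast [Nat.cast_sub hl]
    omega

theorem Represents.evalAt_update (h : Represents n len pos e out st) (c : Fin σ) :
    evalAt (fun c' => (n : ℤ) - Function.update e c 0 c')
      (evalAt (Function.update (fun _ => (n : ℤ)) c (n - e c)) (tableState len pos out)) = st := by
  rw [← h.evalAt_eq, evalAt_evalAt]
  congr 1
  funext c'
  rw [Function.update_apply, Function.update_apply]
  grind

theorem update_zero_le (he : ∀ c, e c ≤ n) (c c' : Fin σ) : Function.update e c 0 c' ≤ n := by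
  rw [Function.update_apply]
  split_ifs
  exacts [n.zero_le, he c']

theorem Represents.flush_of_le (h : Represents n len pos e out st) (hc : len c + e c ≤ n + 1) :
    Represents n len pos (Function.update e c 0) out st where
  __ := h
  e_le := update_zero_le h.e_le c
  evalAt_eq := by
    conv_rhs => rw [← h.evalAt_update c, evalAt_of_le (st := tableState len pos out) fun c' => by
      have := h.len_le c'
      simp only [tableState, Function.update_apply]
      grind]

theorem evalAt_tableState (hlen : ∀ c, len c ≤ n) (he : e c ≤ n) (hc : n + 1 < len c + e c) :
    evalAt (Function.update (fun _ => (n : ℤ)) c (n - e c)) (tableState len pos out) =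
      tableState (Function.update len c (n + 1 - e c)) (Function.update pos c 0)
        (if 0 < pos c then out ++ [pos c] else out) := by
  have hiff (c' : Fin σ) : Function.update (fun _ => (n : ℤ)) c (n - e c) c' < (len c' : ℤ) - 1 ↔
      c' = c := by
    have := hlen c'
    rw [Function.update_apply]
    grind
  ext1
  · ext x
    rw [mem_evalAt_S]
    simp only [tableState, hiff, exists_eq_left]
    split_ifs with hpos <;> simp [hpos, eq_comm, or_comm]
  · funext c'
    simp only [evalAt, evalEntry, tableState, hiff]
    by_cases hcc : c' = c
    · subst hcc
      simp only [if_true, Function.update_self]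
      congr 1
      omega
    · simp only [if_neg hcc, Function.update_of_ne hcc]
  · rfl

theorem Represents.flush_of_lt (h : Represents n len pos e out st) (hc : n + 1 < len c + e c) :
    Represents n (Function.update len c (n + 1 - e c)) (Function.update pos c 0)
      (Function.update e c 0) (if 0 < pos c then out ++ [pos c] else out) st where
  e_le := update_zero_le h.e_le c
  len_le c' := by
    have := h.len_le c
    have := h.len_le c'
    grind [Function.update_apply]
  evalAt_eq := by rw [← evalAt_tableState h.len_le (h.e_le c) hc, h.evalAt_update]
  nodup := by
    split_ifs with hpos
    · exact h.nodup.append (List.nodup_singleton _)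
        (List.disjoint_singleton.2 (h.pos_notMem c hpos))
    · exact h.nodup
  pos_notMem c' hc' := by
    have hne : c' ≠ c := by rintro rfl; simp at hc'
    rw [Function.update_of_ne hne] at hc' ⊢
    have := h.pos_notMem c' hc'
    have := h.pos_inj c' c hc'
    grind
  pos_inj c' c'' hc' heq := by
    have := h.pos_inj c' c''
    grind [Function.update_apply]
  len_pos c' hc' := by
    have := h.len_pos c'
    grind [Function.update_apply]

theorem Represents.R_eq (h : Represents n len pos e out st) (he : e c = 0) :
    st.R c = ⟨(len c : ℤ) - 1, pos c, decide (0 < pos c)⟩ := by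
  have := h.len_le c
  rw [← h.evalAt_eq]
  exact if_neg (by simp only [tableState, he]; omega)

theorem Represents.len_lt_iff (h : Represents n len pos e out st) (he : e c = 0) (l : ℕ) :
    (st.R c).len < (l : ℤ) ↔ len c < l + 1 := by
  rw [h.R_eq he]
  simp only []
  omega

theorem Represents.activate_of_le {l : ℕ} (h : Represents n len pos e out st) (he : e c = 0)
    (hl : l + 1 ≤ len c) (p : ℕ) : Represents n len pos e out (activate l p c st) := by
  rwa [activate, if_neg (mt (h.len_lt_iff he l).1 hl.not_gt)]

/-- If the position `p` is entered for the character `c` whenever `l` exceeds the length of its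
entry, then no position is stored or output twice. -/
structure IsFresh (st : OnePassState σ) (c : Fin σ) (l p : ℕ) : Prop where
  notMem : (st.R c).len < (l : ℤ) → p ∉ st.S
  eq_of_active : ∀ c', (st.R c').active = true → (st.R c').pos = p → c' = c

theorem IsFresh.activate {a : Fin σ} {l p q : ℕ} (h : IsFresh st c l p) (ha : c ≠ a)
    (hq : q ≠ p) : IsFresh (activate l q a st) c l p where
  notMem := by
    rw [activate_R, if_neg fun h => ha h.1, activate_S]
    exact h.notMem
  eq_of_active c' := by
    rw [activate_R]
    split_ifs
    · exact fun _ hp => absurd hp hq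
    · exact h.eq_of_active c'

theorem isFresh_eval_eagerState {b : ℕ → Fin σ} {L y : ℕ → ℕ} {i k : ℕ}
    (hy : Set.InjOn y (Set.Iio n)) (hi : i + 1 < n) (hc : IsCandidate b c (i + 1) k) :
    IsFresh (Suffixient.eval (L (i + 1)) (eagerState b L y i)) c (L (i + 1)) (y k + 1) where
  notMem := notMem_eval_eagerState_S hy hi hc
  eq_of_active c' hactive hpos := by
    obtain ⟨j, k', hp, -, hk⟩ := ((entryInv_eagerState c' i).eq_active_iff _ _).1
      (EntryInv.evalEntry_eq_active_iff.1
        (show evalEntry (L (i + 1)) ((eagerState b L y i).R c') = ⟨_, y k + 1, true⟩ by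
          rw [← hactive, ← hpos]; rfl)).1
    have hkj := hp.cand.2.2.1
    have hji := hp.le
    have hki := hc.2.2.1
    obtain rfl : k' = k := hy (by simp; omega) (by simp; omega) (Nat.succ_injective hk)
    exact hp.cand.2.2.2.symm.trans hc.2.2.2

theorem activate_tableState {l p : ℕ} (hl : len c < l + 1) (hp : 0 < p) :
    activate l p c (tableState len pos out) =
      tableState (Function.update len c (l + 1)) (Function.update pos c p) out := by
  have hlen : ((tableState len pos out).R c).len < (l : ℤ) := by simp only [tableState]; omega
  rw [activate, if_pos hlen]
  ext1
  · rfl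
  · funext c'
    by_cases hcc : c' = c
    · subst hcc
      simp [tableState, hp]
    · simp [tableState, hcc]
  · rfl

theorem Represents.pos_ne {l p : ℕ} (h : Represents n len pos e out st) (hp : 0 < p)
    (hfresh : IsFresh st c l p) (hl : (st.R c).len < (l : ℤ)) {c' : Fin σ} (hc' : c' ≠ c) :
    pos c' ≠ p := by
  rintro rfl
  have hpS := hfresh.notMem hl
  have hactive : ((tableState len pos out).R c').active = true := decide_eq_true hp
  by_cases heval : (n : ℤ) - e c' < ((tableState len pos out).R c').len
  · rw [← h.evalAt_eq, mem_evalAt_S] at hpS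
    exact hpS (Or.inr ⟨c', heval, hactive, rfl⟩)
  · have hR : st.R c' = (tableState len pos out).R c' := by
      rw [← h.evalAt_eq]
      exact if_neg heval
    exact hc' (hfresh.eq_of_active c' (hR ▸ hactive) (hR ▸ rfl))

theorem Represents.activate_of_lt {l p : ℕ} (h : Represents n len pos e out st) (he : e c = 0)
    (hl : len c < l + 1) (hln : l < n) (hp : 0 < p) (hfresh : IsFresh st c l p) :
    Represents n (Function.update len c (l + 1)) (Function.update pos c p) e out
      (activate l p c st) where
  e_le := h.e_le
  len_le c' := by
    have := h.len_le c'
    grind [Function.update_apply]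
  evalAt_eq := by
    have := h.len_le c
    rw [← h.evalAt_eq, activate_evalAt p (by rw [he]; omega) (by simp only [tableState, he]; omega),
      activate_tableState hl hp]
  nodup := h.nodup
  pos_notMem c' hc' := by
    have hout : p ∉ out := fun hout => hfresh.notMem ((h.len_lt_iff he l).2 hl) <| by
      rw [← h.evalAt_eq, mem_evalAt_S]
      exact Or.inl (List.mem_toFinset.2 hout)
    have := h.pos_notMem c'
    grind [Function.update_apply]
  pos_inj c' c'' hc' heq := by
    have hne {c' : Fin σ} : c' ≠ c → pos c' ≠ p := h.pos_ne hp hfresh ((h.len_lt_iff he l).2 hl)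
    have := h.pos_inj c' c''
    grind [Function.update_apply]
  len_pos c' hc' := by
    have := h.len_pos c'
    grind [Function.update_apply]

theorem Represents.mem_eval_neg_one_S_iff (h : Represents n len pos e out st) {x : ℕ} :
    x ∈ (Suffixient.eval (-1) st).S ↔ x ∈ out ∨ ∃ c, 0 < pos c ∧ pos c = x := by
  rw [eval_eq_evalAt, ← h.evalAt_eq, evalAt_evalAt, mem_evalAt_S]
  refine or_congr List.mem_toFinset (exists_congr fun c => ?_)
  have := h.e_le c
  have := h.len_pos c
  simp only [tableState, decide_eq_true_eq]
  grind

theorem Represents.finish (h : Represents n len pos e out st) :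
    (out ++ ((List.finRange σ).map pos).filter (0 < ·)).Nodup ∧
      (out ++ ((List.finRange σ).map pos).filter (0 < ·)).toFinset =
        (Suffixient.eval (-1) st).S := by
  constructor
  · refine h.nodup.append ?_ ?_
    · rw [List.filter_map]
      refine ((List.nodup_finRange σ).filter _).map_on fun c hc c' _ heq => ?_
      exact h.pos_inj c c' (by simpa using List.of_mem_filter hc) heq
    · intro x hx hx'
      obtain ⟨hx', hpos⟩ := List.mem_filter.1 hx'
      obtain ⟨c, -, rfl⟩ := List.mem_map.1 hx'
      exact h.pos_notMem c (of_decide_eq_true hpos) hx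
  · ext x
    rw [h.mem_eval_neg_one_S_iff]
    simp only [List.mem_toFinset, List.mem_append, List.mem_filter, List.mem_map,
      List.mem_finRange, true_and, decide_eq_true_eq]
    grind

end Lazy

/-! ### Programs and trees -/

section Run

/-- The state after the assignment of `v` to the memory cell `a`. -/
def State.setMem (s : State) (a v : ℕ) : State :=
  { s with mem := Function.update s.mem a v }

/-- The state after the output of `v`. -/
def State.emit (s : State) (v : ℕ) : State :=
  { s with out := s.out ++ [v] }

variable {W M : ℕ} {s : State}

theorem State.set_reg (s : State) (x v y : ℕ) :
    (s.set x v).reg y = if y = x then v else s.reg y := by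
  simp only [State.set, Function.update_apply]

theorem State.set_mem (s : State) (x v : ℕ) : (s.set x v).mem = s.mem := rfl

theorem State.set_out (s : State) (x v : ℕ) : (s.set x v).out = s.out := rfl

theorem State.setMem_reg (s : State) (a v : ℕ) : (s.setMem a v).reg = s.reg := rfl

theorem State.setMem_mem (s : State) (a v : ℕ) :
    (s.setMem a v).mem = Function.update s.mem a v := rfl

theorem State.setMem_out (s : State) (a v : ℕ) : (s.setMem a v).out = s.out := rfl

theorem State.emit_reg (s : State) (v : ℕ) : (s.emit v).reg = s.reg := rfl

theorem State.emit_mem (s : State) (v : ℕ) : (s.emit v).mem = s.mem := rfl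

theorem State.emit_out (s : State) (v : ℕ) : (s.emit v).out = s.out ++ [v] := rfl

/-- The total correctness assertion for the program `p` started in the state `s`: it halts, and
the number of steps and the final state satisfy `Q`. -/
def Run (W M : ℕ) (p : Prog) (s : State) (Q : ℕ → State → Prop) : Prop :=
  ∃ t s', Exec W M p s t s' ∧ Q t s'

variable {Q : ℕ → State → Prop}

theorem Run.imp {p : Prog} {Q' : ℕ → State → Prop} (h : Run W M p s Q)
    (hQ : ∀ t s', Q t s' → Q' t s') : Run W M p s Q' := by
  obtain ⟨t, s', hexec, h⟩ := h
  exact ⟨t, s', hexec, hQ t s' h⟩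

theorem run_skip : Run W M .skip s Q ↔ Q 1 s :=
  ⟨fun ⟨_, _, hexec, h⟩ => by cases hexec; exact h, fun h => ⟨_, _, .skip s, h⟩⟩

theorem run_const {x k : ℕ} : Run W M (.const x k) s Q ↔ k < W ∧ Q 1 (s.set x k) :=
  ⟨fun ⟨_, _, hexec, h⟩ => by cases hexec; exact ⟨‹_›, h⟩,
    fun ⟨hk, h⟩ => ⟨_, _, .const s x k hk, h⟩⟩

theorem run_copy {x y : ℕ} : Run W M (.copy x y) s Q ↔ Q 1 (s.set x (s.reg y)) :=
  ⟨fun ⟨_, _, hexec, h⟩ => by cases hexec; exact h, fun h => ⟨_, _, .copy s x y, h⟩⟩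

theorem run_add {x y z : ℕ} :
    Run W M (.add x y z) s Q ↔ s.reg y + s.reg z < W ∧ Q 1 (s.set x (s.reg y + s.reg z)) :=
  ⟨fun ⟨_, _, hexec, h⟩ => by cases hexec; exact ⟨‹_›, h⟩,
    fun ⟨hW, h⟩ => ⟨_, _, .add s x y z hW, h⟩⟩

theorem run_sub {x y z : ℕ} :
    Run W M (.sub x y z) s Q ↔ Q 1 (s.set x (s.reg y - s.reg z)) :=
  ⟨fun ⟨_, _, hexec, h⟩ => by cases hexec; exact h, fun h => ⟨_, _, .sub s x y z, h⟩⟩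

theorem run_load {x y : ℕ} :
    Run W M (.load x y) s Q ↔ s.reg y < M ∧ Q 1 (s.set x (s.mem (s.reg y))) :=
  ⟨fun ⟨_, _, hexec, h⟩ => by cases hexec; exact ⟨‹_›, h⟩,
    fun ⟨hM, h⟩ => ⟨_, _, .load s x y hM, h⟩⟩

theorem run_store {x y : ℕ} :
    Run W M (.store x y) s Q ↔ s.reg x < M ∧ Q 1 (s.setMem (s.reg x) (s.reg y)) :=
  ⟨fun ⟨_, _, hexec, h⟩ => by cases hexec; exact ⟨‹_›, h⟩,
    fun ⟨hM, h⟩ => ⟨_, _, .store s x y hM, h⟩⟩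

theorem run_write {x : ℕ} : Run W M (.write x) s Q ↔ Q 1 (s.emit (s.reg x)) :=
  ⟨fun ⟨_, _, hexec, h⟩ => by cases hexec; exact h, fun h => ⟨_, _, .write s x, h⟩⟩

theorem run_read {x y z a b c : ℕ} {rest : List (ℕ × ℕ × ℕ)} (hinp : s.inp = (a, b, c) :: rest)
    (ha : a < W) (hb : b < W) (hc : c < W)
    (hQ : Q 1 ((({ s with inp := rest }.set x a).set y b).set z c)) :
    Run W M (.read x y z) s Q :=
  ⟨_, _, .read s x y z a b c rest hinp ha hb hc, hQ⟩

theorem run_seq {p q : Prog} :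
    Run W M (.seq p q) s Q ↔
      Run W M p s fun t s' => Run W M q s' fun t' s'' => Q (t + t') s'' := by
  constructor
  · rintro ⟨_, s'', hexec, h⟩
    cases hexec with
    | seq _ _ _ s' _ t t' hp hq => exact ⟨t, s', hp, t', s'', hq, h⟩
  · rintro ⟨t, s', hp, t', s'', hq, h⟩
    exact ⟨_, _, .seq p q s s' s'' t t' hp hq, h⟩

theorem run_ite {x y : ℕ} {p q : Prog} :
    Run W M (.ite x y p q) s Q ↔
      if s.reg x < s.reg y then Run W M p s fun t s' => Q (t + 1) s'
      else Run W M q s fun t s' => Q (t + 1) s' := by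
  constructor
  · rintro ⟨_, s', hexec, h⟩
    cases hexec with
    | ite_true _ _ _ _ _ _ t hlt hp => rw [if_pos hlt]; exact ⟨t, s', hp, h⟩
    | ite_false _ _ _ _ _ _ t hlt hq => rw [if_neg hlt]; exact ⟨t, s', hq, h⟩
  · split_ifs with hlt
    · rintro ⟨t, s', hp, h⟩
      exact ⟨_, _, .ite_true x y p q s s' t hlt hp, h⟩
    · rintro ⟨t, s', hq, h⟩
      exact ⟨_, _, .ite_false x y p q s s' t hlt hq, h⟩

theorem run_loop {x y : ℕ} {p : Prog} (I : ℕ → State → Prop) (f : ℕ → ℕ) (e : ℕ)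
    (hstep : ∀ i s, i < e → I i s →
      s.reg x < s.reg y ∧ Run W M p s fun t s' => t ≤ f i ∧ I (i + 1) s')
    (hend : ∀ s, I e s → ¬ s.reg x < s.reg y) (hs : I 0 s) :
    Run W M (.loop x y p) s fun t s' => t ≤ ∑ i ∈ Finset.range e, (f i + 1) + 1 ∧ I e s' := by
  induction e generalizing I f s with
  | zero => exact ⟨1, s, .loop_false x y p s (hend s hs), by simp, hs⟩
  | succ e ih =>
    obtain ⟨hlt, t, s', hexec, ht, hs'⟩ := hstep 0 s (by omega) hs
    obtain ⟨t', s'', hexec', ht', hs''⟩ := ih (fun i => I (i + 1)) (fun i => f (i + 1))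
      (fun i s hi => hstep (i + 1) s (by omega)) hend hs'
    refine ⟨_, s'', .loop_true x y p s s' s'' t t' hlt hexec hexec', ?_, hs''⟩
    rw [Finset.sum_range_succ']
    omega

theorem run_loop_of_le {x y : ℕ} {p : Prog} (I : ℕ → State → Prop) (f e : ℕ)
    (hstep : ∀ i s, i < e → I i s →
      s.reg x < s.reg y ∧ Run W M p s fun t s' => t ≤ f ∧ I (i + 1) s')
    (hend : ∀ s, I e s → ¬ s.reg x < s.reg y) (hs : I 0 s) :
    Run W M (.loop x y p) s fun t s' => t ≤ e * (f + 1) + 1 ∧ I e s' := by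
  simpa using run_loop I (fun _ => f) e hstep hend hs

/-- `if x ≠ y then p`. -/
def Prog.ifNe (x y : ℕ) (p : Prog) : Prog :=
  .ite x y p (.ite y x p .skip)

theorem run_ifNe {x y : ℕ} {p : Prog} (heq : s.reg x = s.reg y → Q 3 s)
    (hne : s.reg x ≠ s.reg y → Run W M p s fun t s' => Q (t + 1) s' ∧ Q (t + 2) s') :
    Run W M (.ifNe x y p) s Q := by
  simp only [Prog.ifNe, run_ite, run_skip]
  rcases lt_trichotomy (s.reg x) (s.reg y) with hlt | h | hgt
  · rw [if_pos hlt]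
    exact (hne hlt.ne).imp fun _ _ h => h.1
  · rw [if_neg h.not_lt, if_neg h.not_gt]
    exact heq h
  · rw [if_neg hgt.not_gt, if_pos hgt]
    exact (hne hgt.ne').imp fun _ _ h => h.2

/-- `memory[a] := max(memory[a], v)`, with the auxiliary register `t`. -/
def Prog.storeMax (a v t : ℕ) : Prog :=
  .seq (.load t a) (.ite t v (.store a v) .skip)

theorem run_storeMax {a v t : ℕ} (ha : a ≠ t) (hv : v ≠ t) :
    Run W M (.storeMax a v t) s Q ↔ s.reg a < M ∧
      Q 3 ((s.set t (s.mem (s.reg a))).setMem (s.reg a) (max (s.mem (s.reg a)) (s.reg v))) := by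
  simp only [Prog.storeMax, run_seq, run_load, run_ite, run_store, run_skip, State.set_reg,
    if_neg ha, if_neg hv, if_pos]
  refine and_congr_right fun hM => ?_
  split_ifs with hlt
  · simp only [max_eq_right hlt.le, hM, true_and]
  · simp only [max_eq_left (not_lt.1 hlt), State.setMem, State.set_mem, Function.update_eq_self]
    rfl

/-- The registers below `r` and the input stream are the same in two states. -/
structure SameBelow (r : ℕ) (s s' : State) : Prop where
  reg_eq : ∀ x < r, s'.reg x = s.reg x
  inp_eq : s'.inp = s.inp

theorem SameBelow.refl (r : ℕ) (s : State) : SameBelow r s s :=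
  ⟨fun _ _ => rfl, rfl⟩

theorem SameBelow.trans {r : ℕ} {s s' s'' : State} (h : SameBelow r s s')
    (h' : SameBelow r s' s'') : SameBelow r s s'' :=
  ⟨fun x hx => (h'.reg_eq x hx).trans (h.reg_eq x hx), h'.inp_eq.trans h.inp_eq⟩

theorem SameBelow.mono {r r' : ℕ} {s s' : State} (h : SameBelow r s s') (hr : r' ≤ r) :
    SameBelow r' s s' :=
  ⟨fun x hx => h.reg_eq x (hx.trans_le hr), h.inp_eq⟩

theorem sameBelow_set {r x v : ℕ} {s s' : State} (hx : r ≤ x) :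
    SameBelow r s (s'.set x v) ↔ SameBelow r s s' := by
  refine ⟨fun h => ⟨fun y hy => ?_, h.inp_eq⟩, fun h => ⟨fun y hy => ?_, h.inp_eq⟩⟩
  · rw [← h.reg_eq y hy, State.set_reg, if_neg (by omega)]
  · rw [← h.reg_eq y hy, State.set_reg, if_neg (by omega)]

theorem sameBelow_setMem {r a v : ℕ} {s s' : State} :
    SameBelow r s (s'.setMem a v) ↔ SameBelow r s s' :=
  ⟨fun h => ⟨h.reg_eq, h.inp_eq⟩, fun h => ⟨h.reg_eq, h.inp_eq⟩⟩

theorem sameBelow_emit {r v : ℕ} {s s' : State} :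
    SameBelow r s (s'.emit v) ↔ SameBelow r s s' :=
  ⟨fun h => ⟨h.reg_eq, h.inp_eq⟩, fun h => ⟨h.reg_eq, h.inp_eq⟩⟩

end Run

section Tree

/-- The maximum of the numbers that `D` assigns to the node `u` of a heap-ordered binary tree with
the root `1` and to its ancestors. A number stored at a node thus acts on all leaves below it. -/
def ancestorMax (D : ℕ → ℕ) : ℕ → ℕ
  | 0 => 0
  | u + 1 => max (D (u + 1)) (ancestorMax D ((u + 1) / 2))
decreasing_by omega

variable {D : ℕ → ℕ} {u v : ℕ}

theorem ancestorMax_zero (D : ℕ → ℕ) : ancestorMax D 0 = 0 := by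
  rw [ancestorMax]

theorem ancestorMax_of_pos (D : ℕ → ℕ) (hu : 0 < u) :
    ancestorMax D u = max (D u) (ancestorMax D (u / 2)) := by
  obtain ⟨v, rfl⟩ : ∃ v, u = v + 1 := ⟨u - 1, by omega⟩
  rw [ancestorMax]

theorem ancestorMax_eq_self (hu : 0 < u) (h : ancestorMax D (u / 2) = 0) :
    ancestorMax D u = D u := by
  rw [ancestorMax_of_pos D hu, h, max_eq_left (Nat.zero_le _)]

theorem ancestorMax_congr {D' : ℕ → ℕ} (u : ℕ) (h : ∀ v, v ≤ u → D v = D' v) :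
    ancestorMax D u = ancestorMax D' u := by
  induction u using Nat.strong_induction_on with
  | _ u ih =>
    rcases Nat.eq_zero_or_pos u with rfl | hu
    · rw [ancestorMax_zero, ancestorMax_zero]
    · rw [ancestorMax_of_pos D hu, ancestorMax_of_pos D' hu, h u le_rfl,
        ih (u / 2) (by omega) fun v hv => h v (by omega)]

theorem ancestorMax_const_zero (u : ℕ) : ancestorMax (fun _ => 0) u = 0 := by
  induction u using Nat.strong_induction_on with
  | _ u ih =>
    rcases Nat.eq_zero_or_pos u with rfl | hu
    · rw [ancestorMax_zero]
    · rw [ancestorMax_of_pos _ hu, ih (u / 2) (by omega), max_self]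

theorem ancestorMax_update_leaf {σ k : ℕ} (hσ : σ ≤ k) (c : Fin σ)
    (h : ancestorMax D ((k + c) / 2) = 0) :
    (fun c' : Fin σ => ancestorMax (Function.update D (k + c) 0) (k + c')) =
      Function.update (fun c' : Fin σ => ancestorMax D (k + c')) c 0 := by
  funext c'
  have := c'.2
  have hparent : ancestorMax (Function.update D (k + c) 0) ((k + c') / 2) =
      ancestorMax D ((k + c') / 2) :=
    ancestorMax_congr _ fun w hw => Function.update_of_ne (by omega) ..
  rw [ancestorMax_of_pos _ (by omega), hparent]
  by_cases hc : c' = c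
  · rw [hc, h, Function.update_self, Function.update_self, max_self]
  · rw [Function.update_of_ne (by omega), Function.update_of_ne hc,
      ← ancestorMax_of_pos D (by omega)]

theorem ancestorMax_update_root (D : ℕ → ℕ) (d : ℕ) (hu : 0 < u) :
    ancestorMax (Function.update D 1 (max (D 1) d)) u = max d (ancestorMax D u) := by
  induction u using Nat.strong_induction_on with
  | _ u ih =>
    rw [ancestorMax_of_pos _ hu, ancestorMax_of_pos D hu]
    by_cases hu1 : u = 1
    · subst hu1
      simp [ancestorMax_zero, max_comm]
    · rw [ih (u / 2) (by omega) (by omega), Function.update_of_ne hu1, max_left_comm]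

/-- The number stored at the node `v` is moved to the two children of `v`. -/
def pushDown (D : ℕ → ℕ) (v : ℕ) : ℕ → ℕ :=
  Function.update (Function.update (Function.update D v 0) (2 * v) (max (D (2 * v)) (D v)))
    (2 * v + 1) (max (D (2 * v + 1)) (D v))

theorem pushDown_self (D : ℕ → ℕ) (hv : 0 < v) : pushDown D v v = 0 := by
  rw [pushDown, Function.update_of_ne (by omega), Function.update_of_ne (by omega),
    Function.update_self]

theorem pushDown_child (D : ℕ → ℕ) (hu : u / 2 = v) : pushDown D v u = max (D u) (D v) := by
  obtain rfl | rfl : u = 2 * v ∨ u = 2 * v + 1 := by omega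
  · rw [pushDown, Function.update_of_ne (by omega), Function.update_self]
  · rw [pushDown, Function.update_self]

theorem pushDown_of_ne (D : ℕ → ℕ) (hu : u ≠ v) (hu' : u / 2 ≠ v) : pushDown D v u = D u := by
  rw [pushDown, Function.update_of_ne (by omega), Function.update_of_ne (by omega),
    Function.update_of_ne hu]

theorem ancestorMax_pushDown (D : ℕ → ℕ) (hv : 0 < v) (hu : u ≠ v) :
    ancestorMax (pushDown D v) u = ancestorMax D u := by
  induction u using Nat.strong_induction_on with
  | _ u ih =>
    rcases Nat.eq_zero_or_pos u with rfl | hu0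
    · rw [ancestorMax_zero, ancestorMax_zero]
    · rw [ancestorMax_of_pos _ hu0, ancestorMax_of_pos D hu0]
      by_cases huv : u / 2 = v
      · rw [pushDown_child D huv, huv, ancestorMax_of_pos _ hv, ancestorMax_of_pos D hv,
          pushDown_self D hv, ih (v / 2) (by omega) (by omega), Nat.zero_max, max_assoc]
      · rw [ih (u / 2) (by omega) huv, pushDown_of_ne D hu huv]

theorem ancestorMax_pushDown_self (D : ℕ → ℕ) (hv : 0 < v) (h : ancestorMax D (v / 2) = 0) :
    ancestorMax (pushDown D v) v = 0 := by
  rw [ancestorMax_of_pos _ hv, ancestorMax_pushDown D hv (by omega), h, pushDown_self D hv,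
    max_self]

end Tree

/-! ### The program -/

section Program

/- `Exec` fixes only the registers `rN` and `rSigma`. The others are numbered by lifetime, the
constants first and the scratch registers last, so that `SameBelow r` with `r` the first register
that a subprogram uses as scratch says what this subprogram preserves. -/
abbrev rN : ℕ := 0
abbrev rSigma : ℕ := 1
abbrev rOne : ℕ := 2
abbrev rLeaf : ℕ := 3
abbrev rTree : ℕ := 4
abbrev rLen : ℕ := 5
abbrev rPos : ℕ := 6
abbrev rZero : ℕ := 7
abbrev rIndex : ℕ := 8
abbrev rPrevChar : ℕ := 9
abbrev rPrevSA : ℕ := 10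
abbrev rChar : ℕ := 11
abbrev rLCP : ℕ := 12
abbrev rSA : ℕ := 13
abbrev rDelayed : ℕ := 14
abbrev rKey : ℕ := 15
abbrev rNewPos : ℕ := 16
abbrev rNewLen : ℕ := 17
abbrev rRest : ℕ := 18
abbrev rHalf : ℕ := 19
abbrev rNode : ℕ := 20
abbrev rAddr : ℕ := 21
abbrev rValue : ℕ := 22
abbrev rTemp : ℕ := 23
abbrev rLenAddr : ℕ := 24
abbrev rPosAddr : ℕ := 25
abbrev rOldLen : ℕ := 26
abbrev rOldPos : ℕ := 27

/-- The machine has words and a memory that are large enough for texts of length `n` over `σ`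
characters, and `K` is the height of the smallest complete binary tree with `σ` leaves. -/
structure Fits (n σ K W M : ℕ) : Prop where
  two_le : 2 ≤ n
  card_le : σ ≤ n
  card_le_pow : σ ≤ 2 ^ K
  pow_lt_card : ∀ k < K, 2 ^ k < σ
  word_le : 8 * n ≤ W
  mem_le : 8 * n ≤ M

/-- The registers that are set once and for all hold their values. -/
structure Consts (n σ K : ℕ) (s : State) : Prop where
  rN_eq : s.reg rN = n
  rSigma_eq : s.reg rSigma = σ
  rOne_eq : s.reg rOne = 1
  rLeaf_eq : s.reg rLeaf = 2 ^ K
  rTree_eq : s.reg rTree = 2 * n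
  rLen_eq : s.reg rLen = 6 * n
  rPos_eq : s.reg rPos = 7 * n
  rZero_eq : s.reg rZero = 0

/-- The memory holds, one after the other, a table of the halves of the powers of two up to `2 ^ K`
(the machine cannot divide), a tree `D` of delayed updates in heap order, and the tables `len` and
`pos`. -/
structure Layout {σ : ℕ} (n K : ℕ) (mem D : ℕ → ℕ) (len pos : Fin σ → ℕ) : Prop where
  half : ∀ k < K, mem (2 ^ (k + 1)) = 2 ^ k
  tree : ∀ v < 4 * n, mem (2 * n + v) = D v
  len : ∀ c : Fin σ, mem (6 * n + c) = len c
  pos : ∀ c : Fin σ, mem (7 * n + c) = pos c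

variable {n σ K W M : ℕ} {mem D : ℕ → ℕ} {len pos : Fin σ → ℕ} {s : State}

theorem Fits.pow_lt (hf : Fits n σ K W M) : 2 ^ K < 2 * n := by
  have := hf.two_le
  have := hf.card_le
  rcases K with _ | k
  · rw [pow_zero]
    omega
  · have := hf.pow_lt_card k (by omega)
    omega

theorem Fits.pow_succ_lt (hf : Fits n σ K W M) {k : ℕ} (hk : k < K) : 2 ^ (k + 1) < 2 * n :=
  (Nat.pow_le_pow_right (by decide) hk).trans_lt hf.pow_lt

theorem Consts.of_reg_eq {s' : State} (h : Consts n σ K s)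
    (hs : ∀ x < rIndex, s'.reg x = s.reg x) : Consts n σ K s' := by
  obtain ⟨h0, h1, h2, h3, h4, h5, h6, h7⟩ := h
  constructor <;> rw [hs _ (by decide)] <;> assumption

theorem Consts.of_sameBelow {r : ℕ} {s' : State} (h : Consts n σ K s) (hs : SameBelow r s s')
    (hr : rIndex ≤ r) : Consts n σ K s' :=
  h.of_reg_eq fun x hx => hs.reg_eq x (hx.trans_le hr)

theorem Layout.add_half (hf : Fits n σ K W M) {k : ℕ} (h : Layout n k mem D len pos)
    (hk : k < K) : Layout n (k + 1) (Function.update mem (2 ^ (k + 1)) (2 ^ k)) D len pos := by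
  have := hf.pow_succ_lt hk
  refine ⟨fun j hj => ?_, fun u hu => ?_, fun c => ?_, fun c => ?_⟩
  · rcases (Nat.lt_succ_iff.1 hj).eq_or_lt with rfl | hj
    · rw [Function.update_self]
    · rw [Function.update_of_ne (by simpa using hj.ne), h.half j hj]
  · rw [Function.update_of_ne (by omega), h.tree u hu]
  · rw [Function.update_of_ne (by omega), h.len c]
  · rw [Function.update_of_ne (by omega), h.pos c]

theorem Layout.update_tree (h : Layout n K mem D len pos) (hf : Fits n σ K W M) {v : ℕ}
    (hv : v < 4 * n) (x : ℕ) :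
    Layout n K (Function.update mem (2 * n + v) x) (Function.update D v x) len pos := by
  refine ⟨fun k hk => ?_, fun u hu => ?_, fun c => ?_, fun c => ?_⟩
  · have := hf.pow_succ_lt hk
    rw [Function.update_of_ne (by omega), h.half k hk]
  · simp only [Function.update_apply, h.tree u hu, Nat.add_left_cancel_iff]
  · rw [Function.update_of_ne (by omega), h.len c]
  · rw [Function.update_of_ne (by omega), h.pos c]

theorem Layout.update_len (h : Layout n K mem D len pos) (hf : Fits n σ K W M) (c : Fin σ)
    (x : ℕ) : Layout n K (Function.update mem (6 * n + c) x) D (Function.update len c x) pos := by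
  have := hf.card_le
  refine ⟨fun k hk => ?_, fun u hu => ?_, fun c' => ?_, fun c' => ?_⟩
  · have := hf.pow_succ_lt hk
    rw [Function.update_of_ne (by omega), h.half k hk]
  · rw [Function.update_of_ne (by omega), h.tree u hu]
  · simp only [Function.update_apply, h.len c', Nat.add_left_cancel_iff, Fin.val_inj]
  · rw [Function.update_of_ne (by omega), h.pos c']

theorem Layout.update_pos (h : Layout n K mem D len pos) (hf : Fits n σ K W M) (c : Fin σ)
    (x : ℕ) : Layout n K (Function.update mem (7 * n + c) x) D len (Function.update pos c x) := by
  have := hf.card_le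
  refine ⟨fun k hk => ?_, fun u hu => ?_, fun c' => ?_, fun c' => ?_⟩
  · have := hf.pow_succ_lt hk
    rw [Function.update_of_ne (by omega), h.half k hk]
  · rw [Function.update_of_ne (by omega), h.tree u hu]
  · rw [Function.update_of_ne (by omega), h.len c']
  · simp only [Function.update_apply, h.pos c', Nat.add_left_cancel_iff, Fin.val_inj]

/-- Push the number stored at the node `rNode` of the tree down to the children of this node, and
double `rNode`. -/
def pushDownNode : Prog :=
  .seq (.add rAddr rTree rNode) <| .seq (.load rValue rAddr) <| .seq (.store rAddr rZero) <|
  .seq (.add rNode rNode rNode) <|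
  .seq (.add rAddr rTree rNode) <| .seq (.storeMax rAddr rValue rTemp) <|
  .seq (.add rAddr rAddr rOne) (.storeMax rAddr rValue rTemp)

theorem run_pushDownNode (hf : Fits n σ K W M) (hs : Consts n σ K s)
    (hl : Layout n K s.mem D len pos) {v : ℕ} (hv : 0 < v) (hvK : v < 2 ^ K)
    (hnode : s.reg rNode = v) :
    Run W M pushDownNode s fun t s' => t ≤ 12 ∧ SameBelow rNode s s' ∧ s'.out = s.out ∧
      s'.reg rNode = 2 * v ∧ Layout n K s'.mem (pushDown D v) len pos := by
  have hK := hf.pow_lt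
  have hW := hf.word_le
  have hM := hf.mem_le
  have hl₁ := hl.update_tree hf (v := v) (by omega) 0
  have hl₂ := hl₁.update_tree hf (v := 2 * v) (by omega) (max (D (2 * v)) (D v))
  have hl₃ := hl₂.update_tree hf (v := 2 * v + 1) (by omega) (max (D (2 * v + 1)) (D v))
  have hleft : Function.update s.mem (2 * n + v) 0 (2 * n + 2 * v) = D (2 * v) := by
    rw [hl₁.tree (2 * v) (by omega), Function.update_of_ne (by omega)]
  have hright : Function.update (Function.update s.mem (2 * n + v) 0) (2 * n + 2 * v)
      (max (D (2 * v)) (D v)) (2 * n + (2 * v + 1)) = D (2 * v + 1) := by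
    rw [hl₂.tree (2 * v + 1) (by omega), Function.update_of_ne (by omega),
      Function.update_of_ne (by omega)]
  simp +decide only [pushDownNode, run_seq, run_load, run_add, run_store, run_storeMax,
    State.set_reg, State.set_mem, State.setMem_reg, State.setMem_mem, hnode, hs.rOne_eq,
    hs.rTree_eq, hs.rZero_eq, hl.tree v (by omega), hleft, hright, ← Nat.two_mul,
    Nat.add_assoc (2 * n) (2 * v) 1, ne_eq, ↓reduceIte,
    sameBelow_set, sameBelow_setMem, SameBelow.refl]
  exact ⟨by omega, by omega, by omega, by omega, by omega, by omega, by omega, by omega,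
    by norm_num, trivial, rfl, trivial, hl₃⟩

/-- Halve `rHalf`, and go on from the left child `rNode` to the right child if the leaf of number
`rRest` below the parent lies there. -/
def chooseChild : Prog :=
  .seq (.load rHalf rHalf) <|
  .ite rRest rHalf .skip (.seq (.add rNode rNode rOne) (.sub rRest rRest rHalf))

theorem run_chooseChild (hf : Fits n σ K W M) (hs : Consts n σ K s)
    (hl : Layout n K s.mem D len pos) {k v : ℕ} (hk : k < K) (hhalf : s.reg rHalf = 2 ^ (k + 1))
    (hrest : s.reg rRest < 2 ^ (k + 1)) (hnode : s.reg rNode = 2 * v) (hvK : v < 2 ^ K) :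
    Run W M chooseChild s fun t s' => t ≤ 4 ∧ SameBelow rRest s s' ∧ s'.out = s.out ∧
      s'.mem = s.mem ∧ s'.reg rHalf = 2 ^ k ∧ s'.reg rNode / 2 = v ∧ s'.reg rRest < 2 ^ k ∧
      s'.reg rNode * 2 ^ k + s'.reg rRest = v * 2 ^ (k + 1) + s.reg rRest := by
  have hK := hf.pow_lt
  have hkK := hf.pow_succ_lt hk
  have hW := hf.word_le
  have hM := hf.mem_le
  have hpow : 2 ^ (k + 1) = 2 * 2 ^ k := pow_succ' 2 k
  have hmul : v * 2 ^ (k + 1) = 2 * v * 2 ^ k := by rw [hpow]; ring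
  have hmul' : (2 * v + 1) * 2 ^ k = 2 * v * 2 ^ k + 2 ^ k := by ring
  simp +decide only [chooseChild, run_seq, run_load, run_ite, run_skip, run_add, run_sub,
    State.set_reg, State.set_mem, State.set_out, hhalf, hnode, hs.rOne_eq, hl.half k hk,
    ↓reduceIte, sameBelow_set, le_refl, SameBelow.refl, true_and]
  refine ⟨by omega, ?_⟩
  split_ifs with hlt
  · exact ⟨by omega, hlt, by rw [hmul]⟩
  · exact ⟨by omega, by omega, by rw [hmul, hmul']; omega⟩

/-- Move all numbers stored at the ancestors of the leaf of the character `rKey` down the path to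
this leaf, and leave the leaf in `rNode`. -/
def descend : Prog :=
  .seq (.const rNode 1) <| .seq (.copy rRest rKey) <| .seq (.copy rHalf rLeaf) <|
  .loop rOne rHalf (.seq pushDownNode chooseChild)

/-- The situation after `h` rounds of the loop of `descend`, which is started in the state `s₀` and
heads for the leaf `2 ^ K + c`: this is the leaf of number `rRest` below the node `rNode`. -/
structure DescendInv (n K : ℕ) (D : ℕ → ℕ) (len pos : Fin σ → ℕ) (s₀ : State) (c h : ℕ)
    (s : State) : Prop where
  sameBelow : SameBelow rRest s₀ s
  out_eq : s.out = s₀.out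
  half_eq : s.reg rHalf = 2 ^ (K - h)
  leaf_eq : s.reg rNode * 2 ^ (K - h) + s.reg rRest = 2 ^ K + c
  rest_lt : s.reg rRest < 2 ^ (K - h)
  tree : ∃ D', Layout n K s.mem D' len pos ∧
    (∀ u, 2 ^ K ≤ u → ancestorMax D' u = ancestorMax D u) ∧ ancestorMax D' (s.reg rNode / 2) = 0

theorem DescendInv.step (hf : Fits n σ K W M) {s₀ : State} (hs : Consts n σ K s₀) {c h : ℕ}
    (hinv : DescendInv n K D len pos s₀ c h s) (hh : h < K) (hc : c < 2 ^ K) :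
    Run W M (.seq pushDownNode chooseChild) s fun t s' =>
      t ≤ 16 ∧ DescendInv n K D len pos s₀ c (h + 1) s' := by
  obtain ⟨hsame, hout, hhalf, hleaf, hrest, D', hl, hD', hzero⟩ := hinv
  obtain ⟨k, hk⟩ : ∃ k, K - h = k + 1 := ⟨K - h - 1, by omega⟩
  rw [hk] at hhalf hleaf hrest
  have hpow : 2 ^ (k + 1) ≤ 2 ^ K := Nat.pow_le_pow_right (by decide) (by omega)
  have hv : 0 < s.reg rNode := by
    refine Nat.pos_of_ne_zero fun h => ?_
    rw [h] at hleaf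
    omega
  have hvK : s.reg rNode < 2 ^ K := by
    by_contra! hge
    have := Nat.mul_le_mul hge (show 2 ≤ 2 ^ (k + 1) from Nat.le_self_pow (by omega) 2)
    omega
  have hs' := hs.of_sameBelow hsame (by decide)
  refine run_seq.2 ((run_pushDownNode hf hs' hl hv hvK rfl).imp ?_)
  rintro t s₁ ⟨ht, hsame₁, hout₁, hnode₁, hl₁⟩
  refine (run_chooseChild hf (hs'.of_sameBelow hsame₁ (by decide)) hl₁ (by omega)
    ((hsame₁.reg_eq rHalf (by decide)).trans hhalf)
    (by rwa [hsame₁.reg_eq rRest (by decide)]) hnode₁ hvK).imp ?_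
  rintro t' s₂ ⟨ht', hsame₂, hout₂, hmem₂, hhalf₂, hparent₂, hrest₂, hleaf₂⟩
  rw [hsame₁.reg_eq rRest (by decide), hleaf] at hleaf₂
  have hk' : K - (h + 1) = k := by omega
  refine ⟨by omega, ⟨(hsame.trans (hsame₁.mono (by decide))).trans hsame₂, ?_, by rw [hk', hhalf₂],
    by rw [hk', hleaf₂], by rwa [hk'], pushDown D' (s.reg rNode), by rwa [hmem₂],
    fun u hu => ?_, ?_⟩⟩
  · rw [hout₂, hout₁, hout]
  · rw [ancestorMax_pushDown D' hv (by omega), hD' u hu]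
  · rw [hparent₂, ancestorMax_pushDown_self D' hv hzero]

theorem run_descend (hf : Fits n σ K W M) (hs : Consts n σ K s)
    (hl : Layout n K s.mem D len pos) {c : ℕ} (hc : c < 2 ^ K) (hkey : s.reg rKey = c) :
    Run W M descend s fun t s' => t ≤ 17 * K + 4 ∧ SameBelow rRest s s' ∧ s'.out = s.out ∧
      s'.reg rNode = 2 ^ K + c ∧ ∃ D', Layout n K s'.mem D' len pos ∧
        (∀ u, 2 ^ K ≤ u → ancestorMax D' u = ancestorMax D u) ∧
        ancestorMax D' ((2 ^ K + c) / 2) = 0 := by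
  have hn := hf.two_le
  have hW := hf.word_le
  simp +decide only [descend, run_seq, run_const, run_copy, State.set_reg, ↓reduceIte,
    hkey, hs.rLeaf_eq]
  refine ⟨by omega, ?_⟩
  refine (run_loop_of_le (DescendInv n K D len pos s c) 16 K ?_ ?_ ?_).imp ?_
  · intro h s' hh hinv
    refine ⟨?_, hinv.step hf hs hh hc⟩
    rw [hinv.sameBelow.reg_eq rOne (by decide), hs.rOne_eq, hinv.half_eq]
    exact Nat.one_lt_two_pow (by omega)
  · intro s' hinv
    rw [hinv.sameBelow.reg_eq rOne (by decide), hs.rOne_eq, hinv.half_eq]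
    simp
  · refine ⟨?_, rfl, ?_, ?_, ?_, D, hl, fun _ _ => rfl, ?_⟩
    · simp +decide only [sameBelow_set, le_refl, SameBelow.refl]
    all_goals simp +decide only [State.set_reg, ↓reduceIte, Nat.sub_zero, one_mul]
    · exact hc
    · exact ancestorMax_zero D
  · rintro t s' ⟨ht, hsame, hout, -, hleaf, hrest, D', hl', hD', hzero⟩
    rw [Nat.sub_self, pow_zero] at hleaf hrest
    have hnode : s'.reg rNode = 2 ^ K + c := by omega
    exact ⟨by omega, hsame, hout, hnode, D', hl', hD', by rwa [hnode] at hzero⟩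

/-- Take the delayed update from the leaf `rNode`, leave the length of an entry that it expires in
`rTemp`, the addresses of the entry of the character `rKey` in `rLenAddr` and `rPosAddr`, and its
length in `rOldLen`. -/
def loadEntry : Prog :=
  .seq (.add rAddr rTree rNode) <| .seq (.load rValue rAddr) <| .seq (.store rAddr rZero) <|
  .seq (.add rTemp rN rOne) <| .seq (.sub rTemp rTemp rValue) <|
  .seq (.add rLenAddr rLen rKey) <| .seq (.add rPosAddr rPos rKey) (.load rOldLen rLenAddr)

/-- Output the position of the entry at `rLenAddr` and `rPosAddr`, if the entry is active, and
deactivate the entry with the length in `rTemp`. -/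
def report : Prog :=
  .seq (.load rOldPos rPosAddr) <| .seq (.ite rZero rOldPos (.write rOldPos) .skip) <|
  .seq (.store rPosAddr rZero) <| .seq (.store rLenAddr rTemp) (.copy rOldLen rTemp)

/-- Apply the delayed update at the leaf `rNode` to the entry of the character `rKey`. -/
def flush : Prog :=
  .seq loadEntry (.ite rTemp rOldLen report .skip)

theorem run_loadEntry (hf : Fits n σ K W M) (hs : Consts n σ K s)
    (hl : Layout n K s.mem D len pos) {c : Fin σ} (hkey : s.reg rKey = c)
    (hnode : s.reg rNode = 2 ^ K + c) :
    Run W M loadEntry s fun t s' => t ≤ 8 ∧ SameBelow rRest s s' ∧ s'.out = s.out ∧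
      s'.reg rTemp = n + 1 - D (2 ^ K + c) ∧ s'.reg rLenAddr = 6 * n + c ∧
      s'.reg rPosAddr = 7 * n + c ∧ s'.reg rOldLen = len c ∧
      Layout n K s'.mem (Function.update D (2 ^ K + c) 0) len pos := by
  have hn := hf.two_le
  have hK := hf.pow_lt
  have hW := hf.word_le
  have hM := hf.mem_le
  have hc := c.2.trans_le hf.card_le
  have hl' := hl.update_tree hf (v := 2 ^ K + c) (by omega) 0
  simp +decide only [loadEntry, run_seq, run_load, run_add, run_store, run_sub, State.set_reg,
    State.set_mem, State.set_out, State.setMem_reg, State.setMem_mem, State.setMem_out, hnode,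
    hkey, hs.rN_eq, hs.rOne_eq, hs.rTree_eq, hs.rLen_eq, hs.rPos_eq, hs.rZero_eq,
    hl.tree (2 ^ K + c) (by omega), hl'.len c, ↓reduceIte, sameBelow_set,
    sameBelow_setMem, SameBelow.refl, true_and]
  exact ⟨by omega, by omega, by omega, by omega, by omega, by omega, by omega, hl'⟩

theorem run_report (hf : Fits n σ K W M) (hs : Consts n σ K s)
    (hl : Layout n K s.mem D len pos) {c : Fin σ} (hlenAddr : s.reg rLenAddr = 6 * n + c)
    (hposAddr : s.reg rPosAddr = 7 * n + c) :
    Run W M report s fun t s' => t ≤ 6 ∧ SameBelow rTemp s s' ∧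
      s'.out = (if 0 < pos c then s.out ++ [pos c] else s.out) ∧
      s'.reg rLenAddr = 6 * n + c ∧ s'.reg rPosAddr = 7 * n + c ∧
      s'.reg rOldLen = s.reg rTemp ∧
      Layout n K s'.mem D (Function.update len c (s.reg rTemp)) (Function.update pos c 0) := by
  have hM := hf.mem_le
  have hc := c.2.trans_le hf.card_le
  have hl' := (hl.update_pos hf c 0).update_len hf c (s.reg rTemp)
  simp +decide only [report, run_seq, run_load, run_store, run_ite, run_skip, run_copy, run_write,
    State.set_reg, State.set_mem, State.set_out, State.setMem_reg, State.setMem_mem,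
    State.setMem_out, State.emit_reg, State.emit_mem, State.emit_out, hlenAddr, hposAddr,
    hs.rZero_eq, hl.pos c, ↓reduceIte, sameBelow_set, sameBelow_setMem,
    sameBelow_emit, SameBelow.refl, true_and]
  refine ⟨by omega, ?_⟩
  split_ifs with hpos <;> exact ⟨by omega, by omega, rfl, hl'⟩

theorem run_flush (hf : Fits n σ K W M) (hs : Consts n σ K s)
    (hl : Layout n K s.mem D len pos) {st : OnePassState σ} {c : Fin σ}
    (hkey : s.reg rKey = c) (hnode : s.reg rNode = 2 ^ K + c)
    (hrep : Represents n len pos (fun c => ancestorMax D (2 ^ K + c)) s.out st)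
    (hzero : ancestorMax D ((2 ^ K + c) / 2) = 0) :
    Run W M flush s fun t s' => t ≤ 15 ∧ SameBelow rRest s s' ∧
      ∃ D' len' pos', Layout n K s'.mem D' len' pos' ∧
        Represents n len' pos' (fun c => ancestorMax D' (2 ^ K + c)) s'.out st ∧
        ancestorMax D' (2 ^ K + c) = 0 ∧ s'.reg rLenAddr = 6 * n + c ∧
        s'.reg rPosAddr = 7 * n + c ∧ s'.reg rOldLen = len' c := by
  have hupdate := ancestorMax_update_leaf hf.card_le_pow c hzero
  have hzero' : ancestorMax (Function.update D (2 ^ K + c) 0) (2 ^ K + c) = 0 :=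
    (congrFun hupdate c).trans (Function.update_self ..)
  have hleaf := ancestorMax_eq_self (by positivity) hzero
  have hle := hrep.e_le c
  refine run_seq.2 ((run_loadEntry hf hs hl hkey hnode).imp ?_)
  rintro t₁ s₁ ⟨ht₁, hsame₁, hout₁, htemp, hlenAddr, hposAddr, holdLen, hl₁⟩
  rw [run_ite, htemp, holdLen, run_skip]
  split_ifs with hlt
  · have hrep' := hrep.flush_of_lt (c := c) (by omega)
    rw [hleaf, ← hupdate] at hrep'
    refine (run_report hf (hs.of_sameBelow hsame₁ (by decide)) hl₁ hlenAddr hposAddr).imp ?_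
    rintro t₂ s₂ ⟨ht₂, hsame₂, hout₂, hlenAddr₂, hposAddr₂, holdLen₂, hl₂⟩
    rw [htemp] at holdLen₂ hl₂
    refine ⟨by omega, hsame₁.trans (hsame₂.mono (by decide)), _, _, _, hl₂, ?_, hzero',
      hlenAddr₂, hposAddr₂, by rw [holdLen₂, Function.update_self]⟩
    rwa [hout₂, hout₁]
  · have hrep' := hrep.flush_of_le (c := c) (by omega)
    rw [← hupdate] at hrep'
    exact ⟨by omega, hsame₁, _, _, _, hl₁, by rwa [hout₁], hzero', hlenAddr, hposAddr, holdLen⟩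

/-- If the length of the entry of the character `rKey` is smaller than `rNewLen`, then activate this
entry with this length and the position `rNewPos`. -/
def touch : Prog :=
  .seq descend <| .seq flush <|
  .ite rOldLen rNewLen (.seq (.store rLenAddr rNewLen) (.store rPosAddr rNewPos)) .skip

/-- The memory and the output represent the state `st` of the one-pass algorithm, except that the
update `d` of all entries is still to be done. -/
def Stores (n K d : ℕ) (st : OnePassState σ) (s : State) : Prop :=
  ∃ D len pos, Layout n K s.mem D len pos ∧
    Represents n len pos (fun c => max d (ancestorMax D (2 ^ K + c))) s.out st

variable {st : OnePassState σ}

theorem stores_zero_iff : Stores n K 0 st s ↔ ∃ D len pos, Layout n K s.mem D len pos ∧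
    Represents n len pos (fun c => ancestorMax D (2 ^ K + c)) s.out st := by
  simp only [Stores, Nat.zero_max]

theorem run_touch (hf : Fits n σ K W M) (hs : Consts n σ K s) (hst : Stores n K 0 st s)
    {c : Fin σ} {l p : ℕ} (hkey : s.reg rKey = c) (hnewPos : s.reg rNewPos = p)
    (hnewLen : s.reg rNewLen = l + 1) (hl : l < n) (hp : 0 < p) (hfresh : IsFresh st c l p) :
    Run W M touch s fun t s' =>
      t ≤ 17 * K + 22 ∧ SameBelow rRest s s' ∧ Stores n K 0 (activate l p c st) s' := by
  obtain ⟨D, len, pos, hlay, hrep⟩ := stores_zero_iff.1 hst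
  refine run_seq.2 ((run_descend hf hs hlay (c.2.trans_le hf.card_le_pow) hkey).imp ?_)
  rintro t₁ s₁ ⟨ht₁, hsame₁, hout₁, hnode₁, D₁, hlay₁, hD₁, hzero₁⟩
  have hrep₁ : Represents n len pos (fun c => ancestorMax D₁ (2 ^ K + c)) s₁.out st := by
    simpa only [hout₁, hD₁ _ (Nat.le_add_right _ _)] using hrep
  refine run_seq.2 ((run_flush hf (hs.of_sameBelow hsame₁ (by decide)) hlay₁
    ((hsame₁.reg_eq rKey (by decide)).trans hkey) hnode₁ hrep₁ hzero₁).imp ?_)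
  rintro t₂ s₂ ⟨ht₂, hsame₂, D₂, len₂, pos₂, hlay₂, hrep₂, hzero₂, hlenAddr, hposAddr, holdLen⟩
  have hsame := hsame₁.trans hsame₂
  have hM := hf.mem_le
  have hc := c.2.trans_le hf.card_le
  simp +decide only [run_ite, run_seq, run_store, run_skip, State.setMem_reg, State.setMem_mem,
    State.setMem_out, sameBelow_setMem, hlenAddr, hposAddr, holdLen,
    hsame.reg_eq rNewLen (by decide), hsame.reg_eq rNewPos (by decide), hnewLen, hnewPos,
    stores_zero_iff]
  split_ifs with hlt
  · exact ⟨by omega, by omega, by omega, hsame, D₂, _, _,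
      (hlay₂.update_len hf c (l + 1)).update_pos hf c p,
      hrep₂.activate_of_lt hzero₂ hlt hl hp hfresh⟩
  · exact ⟨by omega, hsame, D₂, _, _, hlay₂, hrep₂.activate_of_le hzero₂ (by omega) p⟩

/-- Enter the candidate of the character `x` at the suffix of the reversed text that starts at `y`,
for the current entry `rLCP` of the LCP array. -/
def touchEntry (x y : ℕ) : Prog :=
  .seq (.copy rKey x) <| .seq (.sub rNewPos rN y) <| .seq (.add rNewPos rNewPos rOne) <|
  .seq (.add rNewLen rLCP rOne) touch

/-- Record the delayed update of all entries at the root of the tree. -/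
def applyDelayed : Prog :=
  .seq (.add rAddr rTree rOne) <| .seq (.storeMax rAddr rDelayed rTemp) (.const rDelayed 0)

/-- Handle the run boundary between the previous and the current triple. -/
def boundary : Prog :=
  .seq applyDelayed <| .seq (touchEntry rPrevChar rPrevSA) (touchEntry rChar rSA)

theorem run_touchEntry (hf : Fits n σ K W M) (hs : Consts n σ K s) (hst : Stores n K 0 st s)
    {x y q : ℕ} {c : Fin σ} (hx : s.reg x = c) (hy : y < rKey) (hq : s.reg y = n - q)
    (hqn : q < n) (hl : s.reg rLCP < n) (hfresh : IsFresh st c (s.reg rLCP) (q + 1)) :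
    Run W M (touchEntry x y) s fun t s' => t ≤ 17 * K + 26 ∧ SameBelow rKey s s' ∧
      Stores n K 0 (activate (s.reg rLCP) (q + 1) c st) s' := by
  have hW := hf.word_le
  have hyne : y ≠ rKey := hy.ne
  have hsub : n - (n - q) = q := by omega
  simp +decide only [touchEntry, run_seq, run_copy, run_sub, run_add, State.set_reg, ↓reduceIte,
    if_neg hyne, hx, hq, hsub, hs.rN_eq, hs.rOne_eq]
  refine ⟨by omega, by omega, ?_⟩
  set s₁ := (((s.set rKey c).set rNewPos q).set rNewPos (q + 1)).set rNewLen (s.reg rLCP + 1)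
    with hs₁
  have hsame₁ : SameBelow rKey s s₁ := by
    simp +decide only [hs₁, sameBelow_set, le_refl, SameBelow.refl]
  have hst₁ : Stores n K 0 st s₁ := hst
  refine (run_touch hf (hs.of_sameBelow hsame₁ (by decide)) hst₁ (c := c) rfl rfl rfl hl
    q.succ_pos hfresh).imp ?_
  rintro t s' ⟨ht, hsame, hst'⟩
  exact ⟨by omega, hsame₁.trans (hsame.mono (by decide)), hst'⟩

theorem run_applyDelayed (hf : Fits n σ K W M) (hs : Consts n σ K s)
    (hst : Stores n K (s.reg rDelayed) st s) :
    Run W M applyDelayed s fun t s' =>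
      t ≤ 5 ∧ SameBelow rDelayed s s' ∧ s'.reg rDelayed = 0 ∧ Stores n K 0 st s' := by
  obtain ⟨D, len, pos, hlay, hrep⟩ := hst
  have hn := hf.two_le
  have hW := hf.word_le
  have hM := hf.mem_le
  simp +decide only [applyDelayed, run_seq, run_add, run_storeMax, run_const, State.set_reg,
    State.set_mem, State.set_out, State.setMem_mem, State.setMem_out, ne_eq,
    ↓reduceIte, hs.rTree_eq, hs.rOne_eq, hlay.tree 1 (by omega), stores_zero_iff, sameBelow_set,
    sameBelow_setMem, le_refl, SameBelow.refl, true_and]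
  refine ⟨by omega, by omega, by omega, _, _, _, hlay.update_tree hf (v := 1) (by omega) _, ?_⟩
  have hroot (c : Fin σ) :=
    ancestorMax_update_root D (s.reg rDelayed) (u := 2 ^ K + c) (by positivity)
  simpa only [hroot] using hrep

theorem run_boundary (hf : Fits n σ K W M) (hs : Consts n σ K s)
    (hst : Stores n K (s.reg rDelayed) st s) {a c : Fin σ} {l p q : ℕ}
    (hprevChar : s.reg rPrevChar = a) (hprevSA : s.reg rPrevSA = n - p) (hchar : s.reg rChar = c)
    (hSA : s.reg rSA = n - q) (hLCP : s.reg rLCP = l) (hpn : p < n) (hqn : q < n) (hl : l < n)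
    (hac : c ≠ a) (hpq : p ≠ q) (hp : IsFresh st a l (p + 1)) (hq : IsFresh st c l (q + 1)) :
    Run W M boundary s fun t s' => t ≤ 34 * K + 57 ∧ SameBelow rDelayed s s' ∧
      Stores n K (s'.reg rDelayed) (activate l (q + 1) c (activate l (p + 1) a st)) s' := by
  subst hLCP
  refine run_seq.2 ((run_applyDelayed hf hs hst).imp ?_)
  rintro t₁ s₁ ⟨ht₁, hsame₁, hdelayed, hst₁⟩
  have hLCP₁ := hsame₁.reg_eq rLCP (by decide)
  have hs₁ := hs.of_sameBelow hsame₁ (by decide)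
  refine run_seq.2 ((run_touchEntry hf hs₁ hst₁ (c := a) (q := p) ?_ (by decide) ?_ hpn ?_
    ?_).imp ?_)
  · rw [hsame₁.reg_eq rPrevChar (by decide), hprevChar]
  · rw [hsame₁.reg_eq rPrevSA (by decide), hprevSA]
  · rwa [hLCP₁]
  · rwa [hLCP₁]
  rintro t₂ s₂ ⟨ht₂, hsame₂, hst₂⟩
  have hsame := hsame₁.trans (hsame₂.mono (by decide))
  have hLCP := hsame.reg_eq rLCP (by decide)
  rw [hLCP₁] at hst₂
  refine (run_touchEntry hf (hs.of_sameBelow hsame (by decide)) hst₂ (c := c) (q := q)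
    ?_ (by decide) ?_ hqn ?_ ?_).imp ?_
  · rw [hsame.reg_eq rChar (by decide), hchar]
  · rw [hsame.reg_eq rSA (by decide), hSA]
  · rwa [hLCP]
  · rw [hLCP]
    exact hq.activate hac (by omega)
  rintro t₃ s₃ ⟨ht₃, hsame₃, hst₃⟩
  rw [hLCP] at hst₃
  refine ⟨by omega, hsame.trans (hsame₃.mono (by decide)), ?_⟩
  rwa [hsame₃.reg_eq rDelayed (by decide), hsame₂.reg_eq rDelayed (by decide), hdelayed]

end Program

section Iteration

/-- Read the next triple, and delay the update `eval` of all entries with its LCP value. -/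
def fetch : Prog :=
  .seq (.read rChar rLCP rSA) <| .seq (.sub rTemp rN rLCP) <|
  .ite rDelayed rTemp (.copy rDelayed rTemp) .skip

/-- An iteration of the main loop. -/
def iteration : Prog :=
  .seq fetch <| .seq (.ifNe rPrevChar rChar boundary) <|
  .seq (.copy rPrevChar rChar) <| .seq (.copy rPrevSA rSA) (.add rIndex rIndex rOne)

variable {n σ K W M d : ℕ} {s : State} {st : OnePassState σ}

theorem Stores.eval {l : ℕ} (hst : Stores n K d st s) (hl : l ≤ n) :
    Stores n K (max d (n - l)) (eval l st) s := by
  obtain ⟨D, len, pos, hlay, hrep⟩ := hst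
  refine ⟨D, len, pos, hlay, ?_⟩
  simpa only [max_right_comm] using hrep.eval hl

theorem run_fetch (hf : Fits n σ K W M) (hs : Consts n σ K s)
    (hst : Stores n K (s.reg rDelayed) st s) {a l p : ℕ} {rest : List (ℕ × ℕ × ℕ)}
    (hinp : s.inp = (a, l, p) :: rest) (ha : a < n) (hl : l < n) (hp : p ≤ n) :
    Run W M fetch s fun t s' => t ≤ 4 ∧ SameBelow rChar { s with inp := rest } s' ∧
      s'.reg rChar = a ∧ s'.reg rLCP = l ∧ s'.reg rSA = p ∧
      Stores n K (s'.reg rDelayed) (eval l st) s' := by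
  have hW := hf.word_le
  have hst' := hst.eval hl.le
  refine run_seq.2 (run_read hinp (by omega) (by omega) (by omega) ?_)
  simp +decide only [run_seq, run_sub, run_ite, run_copy, run_skip, State.set_reg, ↓reduceIte,
    hs.rN_eq, sameBelow_set, SameBelow.refl, true_and]
  split_ifs with hlt
  · rwa [max_eq_right hlt.le] at hst'
  · rwa [max_eq_left (not_lt.1 hlt)] at hst'

variable {T : List (Fin σ)} {b : ℕ → Fin σ} {L y : ℕ → ℕ} {i : ℕ}

theorem IsArrays.lcp_lt (h : IsArrays T b L y) {k : ℕ} (hk : k < T.length) : L k < T.length := by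
  rcases k with _ | k
  · rwa [h.lcp_zero]
  · have hcommon := (h.le_lcp_iff k (k + 1) k.lt_succ_self hk (L (k + 1))).1 fun t ht => by
      rw [show t = k + 1 by have := ht.1; have := ht.2; omega]
    exact hcommon.2.1.trans_lt (h.bijOn.mapsTo hk)

theorem run_ifNe_boundary (hf : Fits T.length σ K W M) (h : IsArrays T b L y)
    (hi : i + 1 < T.length) (hs : Consts T.length σ K s) (hprevChar : s.reg rPrevChar = b i)
    (hprevSA : s.reg rPrevSA = T.length - y i) (hchar : s.reg rChar = b (i + 1))
    (hLCP : s.reg rLCP = L (i + 1)) (hSA : s.reg rSA = T.length - y (i + 1))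
    (hst : Stores T.length K (s.reg rDelayed) (eval (L (i + 1)) (eagerState b L y i)) s) :
    Run W M (.ifNe rPrevChar rChar boundary) s fun t s' =>
      t ≤ 3 + (if b (i + 1) ≠ b i then 34 * K + 56 else 0) ∧ SameBelow rDelayed s s' ∧
      Stores T.length K (s'.reg rDelayed) (eagerState b L y (i + 1)) s' := by
  rw [eagerState, eagerStep, Nat.add_sub_cancel]
  refine run_ifNe (fun heq => ?_) fun hne => ?_
  · rw [hprevChar, hchar] at heq
    have heq' : b (i + 1) = b i := (Fin.val_injective heq).symm
    rw [if_neg (not_not.2 heq'), if_neg (not_not.2 heq')]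
    exact ⟨le_rfl, .refl _ _, hst⟩
  · rw [hprevChar, hchar] at hne
    have hne' : b (i + 1) ≠ b i := fun h => hne (congrArg _ h.symm)
    have hinj := h.bijOn.injOn
    rw [if_pos hne', if_pos hne']
    refine (run_boundary hf hs hst hprevChar hprevSA hchar hSA hLCP
      (h.bijOn.mapsTo (show i < T.length by omega)) (h.bijOn.mapsTo hi) (h.lcp_lt hi) hne'
      (fun heq => i.lt_succ_self.ne (hinj (show i < T.length by omega) hi heq))
      (isFresh_eval_eagerState hinj hi ⟨i.succ_pos, hne', .inr rfl, rfl⟩)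
      (isFresh_eval_eagerState hinj hi ⟨i.succ_pos, hne', .inl rfl, rfl⟩)).imp ?_
    rintro t s' ⟨ht, hrest⟩
    exact ⟨⟨by omega, hrest⟩, ⟨by omega, hrest⟩⟩

/-- The situation after `i` rounds of the main loop, when the triples of the indices `0, …, i` have
been read. -/
structure MainInv (T : List (Fin σ)) (K : ℕ) (b : ℕ → Fin σ) (L y : ℕ → ℕ) (i : ℕ) (s : State) :
    Prop where
  consts : Consts T.length σ K s
  index_eq : s.reg rIndex = i + 1
  prevChar_eq : s.reg rPrevChar = b i
  prevSA_eq : s.reg rPrevSA = T.length - y i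
  inp_eq : s.inp = (List.range' (i + 1) (T.length - (i + 1))).map
    fun k => ((b k : ℕ), L k, T.length - y k)
  stores : Stores T.length K (s.reg rDelayed) (eagerState b L y i) s

theorem MainInv.step (hf : Fits T.length σ K W M) (h : IsArrays T b L y)
    (hi : i + 1 < T.length) (hinv : MainInv T K b L y i s) :
    Run W M iteration s fun t s' =>
      t ≤ 10 + (if b (i + 1) ≠ b i then 34 * K + 56 else 0) ∧ MainInv T K b L y (i + 1) s' := by
  obtain ⟨hs, hindex, hprevChar, hprevSA, hinp, hst⟩ := hinv
  have hW := hf.word_le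
  rw [show T.length - (i + 1) = T.length - (i + 1 + 1) + 1 by omega, List.range'_succ,
    List.map_cons] at hinp
  refine run_seq.2 ((run_fetch hf hs hst hinp ((b (i + 1)).2.trans_le hf.card_le) (h.lcp_lt hi)
    (Nat.sub_le ..)).imp ?_)
  rintro t₁ s₁ ⟨ht₁, hsame₁, hchar₁, hLCP₁, hSA₁, hst₁⟩
  refine run_seq.2 ((run_ifNe_boundary hf h hi (hs.of_reg_eq fun x hx => ?_) ?_ ?_ hchar₁ hLCP₁
    hSA₁ hst₁).imp ?_)
  · exact hsame₁.reg_eq x (hx.trans (by decide))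
  · exact (hsame₁.reg_eq _ (by decide)).trans hprevChar
  · exact (hsame₁.reg_eq _ (by decide)).trans hprevSA
  rintro t₂ s₂ ⟨ht₂, hsame₂, hst₂⟩
  have hsame := hsame₁.trans (hsame₂.mono (by decide))
  have hindex₂ : s₂.reg rIndex = i + 1 := (hsame.reg_eq _ (by decide)).trans hindex
  have hs₂ : Consts T.length σ K s₂ :=
    hs.of_reg_eq fun x hx => hsame.reg_eq x (hx.trans (by decide))
  simp +decide only [run_seq, run_copy, run_add, State.set_reg, ↓reduceIte, hindex₂, hs₂.rOne_eq]
  refine ⟨by omega, by omega, hs₂.of_sameBelow (r := rIndex) ?_ le_rfl, ?_, ?_, ?_,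
    hsame.inp_eq, hst₂⟩
  all_goals simp +decide only [sameBelow_set, SameBelow.refl, State.set_reg, ↓reduceIte]
  · rw [hsame₂.reg_eq _ (by decide), hchar₁]
  · rw [hsame₂.reg_eq _ (by decide), hSA₁]

end Iteration

section Setup

/-- Set the constants, up to the number `rLeaf` of the leaves of the tree. -/
def setConstants : Prog :=
  .seq (.const rOne 1) <| .seq (.const rLeaf 1) <| .seq (.add rTree rN rN) <|
  .seq (.add rLen rTree rTree) <| .seq (.add rLen rLen rTree) (.add rPos rLen rN)

/-- Double `rLeaf` until the tree has enough leaves, and record the halves of the powers of two. -/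
def fillHalfTable : Prog :=
  .loop rLeaf rSigma <|
    .seq (.add rTemp rLeaf rLeaf) <| .seq (.store rTemp rLeaf) (.copy rLeaf rTemp)

/-- Output the positions of all active entries. -/
def finish : Prog :=
  .seq (.const rIndex 0) <| .loop rIndex rSigma <|
    .seq (.add rAddr rPos rIndex) <| .seq (.load rValue rAddr) <|
    .seq (.ite rZero rValue (.write rValue) .skip) (.add rIndex rIndex rOne)

/-- The one-pass algorithm. -/
def onePassProg : Prog :=
  .seq setConstants <| .seq fillHalfTable <| .seq (.read rPrevChar rLCP rPrevSA) <|
  .seq (.const rIndex 1) <| .seq (.loop rIndex rN iteration) finish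

variable {n σ K W M d : ℕ} {mem D : ℕ → ℕ} {len pos : Fin σ → ℕ} {s : State}
  {st : OnePassState σ} {T : List (Fin σ)} {b : ℕ → Fin σ} {L y : ℕ → ℕ}

/-- The situation after `h` rounds of the loop of `fillHalfTable`, which is started in a state with
the input `inp`. -/
structure FillInv (n σ : ℕ) (inp : List (ℕ × ℕ × ℕ)) (h : ℕ) (s : State) : Prop where
  consts : Consts n σ h s
  delayed_eq : s.reg rDelayed = 0
  inp_eq : s.inp = inp
  out_eq : s.out = []
  layout : Layout (σ := σ) n h s.mem (fun _ => 0) (fun _ => 0) (fun _ => 0)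

theorem run_setConstants (hf : Fits T.length σ K W M) :
    Run W M setConstants (initState T) fun t s' => t ≤ 6 ∧
      FillInv T.length σ (initState T).inp 0 s' := by
  have hn := hf.two_le
  have hW := hf.word_le
  have hN : (initState T).reg rN = T.length := rfl
  simp +decide only [setConstants, run_seq, run_const, run_add, State.set_reg, ↓reduceIte, hN]
  refine ⟨by omega, by omega, by omega, by omega, by omega, by omega, trivial, ?_, rfl, rfl, rfl,
    ?_, fun _ _ => rfl, fun _ => rfl, fun _ => rfl⟩
  · constructor <;> simp +decide only [State.set_reg, ↓reduceIte, hN] <;> first | rfl | omega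
  · exact fun k hk => absurd hk k.not_lt_zero

theorem FillInv.step (hf : Fits n σ K W M) {inp : List (ℕ × ℕ × ℕ)} {h : ℕ}
    (hinv : FillInv n σ inp h s) (hh : h < K) :
    Run W M (.seq (.add rTemp rLeaf rLeaf) (.seq (.store rTemp rLeaf) (.copy rLeaf rTemp))) s
      fun t s' => t ≤ 3 ∧ FillInv n σ inp (h + 1) s' := by
  obtain ⟨hs, hdelayed, hinp, hout, hlay⟩ := hinv
  have hpow := hf.pow_succ_lt hh
  have hW := hf.word_le
  have hM := hf.mem_le
  have hdouble : 2 ^ h + 2 ^ h = 2 ^ (h + 1) := by ring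
  simp +decide only [run_seq, run_add, run_store, run_copy, State.set_reg, State.setMem_reg,
    ↓reduceIte, hs.rLeaf_eq, hdouble]
  refine ⟨by omega, by omega, trivial, ?_, hdelayed, hinp, hout, hlay.add_half hf hh⟩
  obtain ⟨h0, h1, h2, -, h4, h5, h6, h7⟩ := hs
  constructor <;> simp +decide only [State.set_reg, State.setMem_reg, ↓reduceIte, *]

theorem run_fillHalfTable (hf : Fits n σ K W M) {inp : List (ℕ × ℕ × ℕ)}
    (hinv : FillInv n σ inp 0 s) :
    Run W M fillHalfTable s fun t s' => t ≤ 4 * K + 1 ∧ FillInv n σ inp K s' := by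
  refine (run_loop_of_le (FillInv n σ inp) 3 K (fun h s' hh hinv => ⟨?_, hinv.step hf hh⟩)
    (fun s' hinv => ?_) hinv).imp ?_
  · rw [hinv.consts.rLeaf_eq, hinv.consts.rSigma_eq]
    exact hf.pow_lt_card h hh
  · rw [hinv.consts.rLeaf_eq, hinv.consts.rSigma_eq]
    exact hf.card_le_pow.not_gt
  · rintro t s' ⟨ht, hinv⟩
    exact ⟨by omega, hinv⟩

theorem FillInv.stores {inp : List (ℕ × ℕ × ℕ)} (hinv : FillInv n σ inp K s) :
    Stores n K 0 (onePassInit σ) s := by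
  refine stores_zero_iff.2 ⟨_, _, _, hinv.layout, ?_⟩
  simpa only [ancestorMax_const_zero, hinv.out_eq] using represents_init n

/-- The situation after `j` rounds of the loop of `finish`, which is started in the state `s₀`. -/
structure FinishInv (pos : Fin σ → ℕ) (s₀ : State) (j : ℕ) (s : State) : Prop where
  sameBelow : SameBelow rIndex s₀ s
  index_eq : s.reg rIndex = j
  mem_eq : s.mem = s₀.mem
  out_eq : s.out = s₀.out ++ (((List.finRange σ).take j).map pos).filter (0 < ·)

theorem FinishInv.step (hf : Fits n σ K W M) {s₀ : State} (hs₀ : Consts n σ K s₀)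
    (hlay : Layout n K s₀.mem D len pos) {j : ℕ} (hj : j < σ) (hinv : FinishInv pos s₀ j s) :
    Run W M (.seq (.add rAddr rPos rIndex) <| .seq (.load rValue rAddr) <|
      .seq (.ite rZero rValue (.write rValue) .skip) (.add rIndex rIndex rOne)) s
      fun t s' => t ≤ 5 ∧ FinishInv pos s₀ (j + 1) s' := by
  obtain ⟨hsame, hindex, hmem, hout⟩ := hinv
  have hs := hs₀.of_sameBelow hsame le_rfl
  have hσ := hf.card_le
  have hW := hf.word_le
  have hM := hf.mem_le
  have hload : s.mem (7 * n + j) = pos ⟨j, hj⟩ := hmem ▸ hlay.pos ⟨j, hj⟩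
  have htake : (List.finRange σ).take (j + 1) = (List.finRange σ).take j ++ [⟨j, hj⟩] := by
    rw [List.take_add_one, List.getElem?_eq_getElem (by simpa using hj), List.getElem_finRange]
    rfl
  simp +decide only [run_seq, run_add, run_load, run_ite, run_write, run_skip, State.set_reg,
    State.emit_reg, State.set_mem, ↓reduceIte, hindex, hload, hs.rOne_eq, hs.rPos_eq, hs.rZero_eq]
  refine ⟨by omega, by omega, ?_⟩
  split_ifs with hpos <;> refine ⟨by omega, by decide, ?_, ?_, hmem, ?_⟩
  all_goals simp +decide only [sameBelow_set, sameBelow_emit, State.set_reg, State.set_out,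
    State.emit_out, ↓reduceIte, hsame, htake, hout, List.map_append, List.filter_append,
    List.map_cons, List.map_nil, List.append_assoc]
  · simp [hpos]
  · simp [hpos]

theorem run_finish (hf : Fits n σ K W M) (hs : Consts n σ K s) (hst : Stores n K d st s) :
    Run W M finish s fun t s' =>
      t ≤ 6 * σ + 2 ∧ s'.out.Nodup ∧ s'.out.toFinset = (eval (-1) st).S := by
  obtain ⟨D, len, pos, hlay, hrep⟩ := hst
  refine run_seq.2 (run_const.2 ⟨by have := hf.two_le; have := hf.word_le; omega, ?_⟩)
  refine (run_loop_of_le (s := s.set rIndex 0) (FinishInv pos s) 5 σ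
    (fun j s' hj hinv => ⟨?_, ?_⟩) (fun s' hinv => ?_) ⟨?_, ?_, rfl, ?_⟩).imp ?_
  · rwa [hinv.index_eq, hinv.sameBelow.reg_eq rSigma (by decide), hs.rSigma_eq]
  · exact hinv.step hf hs hlay hj
  · rw [hinv.index_eq, hinv.sameBelow.reg_eq rSigma (by decide), hs.rSigma_eq]
    exact lt_irrefl σ
  · exact (sameBelow_set le_rfl).2 (.refl _ _)
  · simp only [State.set_reg, if_true]
  · simp [State.set_out]
  · rintro t s' ⟨ht, hinv⟩
    have hout := hinv.out_eq
    rw [List.take_of_length_le (List.length_finRange).le] at hout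
    rw [hout]
    exact ⟨by omega, hrep.finish⟩

theorem IsArrays.initState_inp (h : IsArrays T b L y) (hT : 0 < T.length) :
    (initState T).inp = ((b 0 : ℕ), L 0, T.length - y 0) ::
      (List.range' 1 (T.length - 1)).map fun k => ((b k : ℕ), L k, T.length - y k) := by
  rw [initState, h.arrays_eq, List.map_map, List.range_eq_range',
    show T.length = T.length - 1 + 1 by omega, List.range'_succ]
  rfl

theorem run_onePassProg (hf : Fits T.length σ K W M) (h : IsArrays T b L y) :
    Run W M onePassProg (initState T) fun t s' =>
      t ≤ 4 * K + 6 * σ + 12 + ∑ i ∈ Finset.range (T.length - 1),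
        (10 + (if b (i + 1) ≠ b i then 34 * K + 56 else 0) + 1) ∧
      s'.out.Nodup ∧ s'.out.toFinset = onePass T := by
  have hn := hf.two_le
  have hσ := hf.card_le
  have hW := hf.word_le
  refine run_seq.2 ((run_setConstants hf).imp ?_)
  rintro t₁ s₁ ⟨ht₁, hinv₁⟩
  refine run_seq.2 ((run_fillHalfTable hf hinv₁).imp ?_)
  rintro t₂ s₂ ⟨ht₂, hinv₂⟩
  refine run_seq.2 (run_read (hinv₂.inp_eq.trans (h.initState_inp (by omega)))
    ((b 0).2.trans_le (by omega)) ((h.lcp_lt (by omega)).trans_le (by omega)) (by omega) ?_)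
  refine run_seq.2 (run_const.2 ⟨by omega, ?_⟩)
  refine run_seq.2 ((run_loop (MainInv T K b L y) _ (T.length - 1)
    (fun i s hi hinv => ⟨?_, hinv.step hf h (by omega)⟩) (fun s hinv => ?_)
    ⟨hinv₂.consts.of_reg_eq fun x hx => ?_, ?_, ?_, ?_, rfl, ?_⟩).imp ?_)
  · rw [hinv.index_eq, hinv.consts.rN_eq]
    omega
  · rw [hinv.index_eq, hinv.consts.rN_eq]
    omega
  · simp only [State.set_reg]
    rw [if_neg, if_neg, if_neg, if_neg] <;> exact (hx.trans_le (by decide)).ne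
  · simp +decide only [State.set_reg, ↓reduceIte]
  · simp +decide only [State.set_reg, ↓reduceIte]
  · simp +decide only [State.set_reg, ↓reduceIte]
  · simp +decide only [State.set_reg, ↓reduceIte, hinv₂.delayed_eq]
    exact hinv₂.stores
  rintro t₃ s₃ ⟨ht₃, hinv₃⟩
  refine (run_finish hf hinv₃.consts hinv₃.stores).imp ?_
  rintro t₄ s₄ ⟨ht₄, hnodup, hout⟩
  exact ⟨by omega, hnodup, by rw [hout, onePass_eq_eager h]⟩

end Setup

/-! ### Running time -/

section Time

theorem length_splitBy_loop {α : Type*} (r : α → α → Bool) (l : List α) (a : α) (g : List α)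
    (gs : List (List α)) :
    (List.splitBy.loop r l a g gs).length =
      gs.length + 1 + ((a :: l).zip l).countP fun p => !r p.1 p.2 := by
  induction l generalizing a g gs with
  | nil => simp [List.splitBy.loop]
  | cons c l ih =>
    rw [List.splitBy.loop, List.zip_cons_cons, List.countP_cons]
    cases r a c
    · rw [ih, List.length_cons]
      simp only [Bool.not_false, if_true]
      omega
    · rw [ih]
      simp

theorem runs_eq_add_countP {α : Type*} [DecidableEq α] {l : List α} (hl : l ≠ []) :
    runs l = 1 + (l.zip l.tail).countP fun p => p.1 ≠ p.2 := by
  obtain ⟨a, l, rfl⟩ := List.exists_cons_of_ne_nil hl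
  rw [runs, List.splitBy, length_splitBy_loop, List.length_nil, zero_add, List.tail_cons]
  exact congrArg _ (List.countP_congr fun p _ => by simp)

variable {σ : ℕ} {T : List (Fin σ)} {b : ℕ → Fin σ} {L y : ℕ → ℕ}

theorem IsArrays.rBar_eq (h : IsArrays T b L y) (hT : T ≠ []) :
    rBar T = 1 + ((Finset.range (T.length - 1)).filter fun i => b (i + 1) ≠ b i).card := by
  have hne : (List.range T.length).map b ≠ [] := by simpa using hT
  rw [rBar, h.bwt_eq, runs_eq_add_countP hne, zip_tail_map_range, List.countP_map,
    ← Nat.count_eq_card_filter_range, Nat.count]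
  exact congrArg _ (List.countP_congr fun i _ => by simpa using ne_comm)

theorem IsArrays.time_le (h : IsArrays T b L y) (hT : 2 ≤ T.length) (hσ : σ ≤ T.length)
    {K t : ℕ} (hK : 0 < K) (ht : t ≤ 4 * K + 6 * σ + 12 + ∑ i ∈ Finset.range (T.length - 1),
      (10 + (if b (i + 1) ≠ b i then 34 * K + 56 else 0) + 1)) :
    t ≤ 23 * T.length + 90 * (rBar T * K) := by
  rw [h.rBar_eq (List.ne_nil_of_length_pos (by omega))]
  simp only [Finset.sum_add_distrib, Finset.sum_const, Finset.card_range, ← Finset.sum_filter,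
    smul_eq_mul] at ht
  set r := ((Finset.range (T.length - 1)).filter fun i => b (i + 1) ≠ b i).card
  have hr : r ≤ r * K := Nat.le_mul_of_pos_right r hK
  have hmul : r * (34 * K) = 34 * (r * K) := by ring
  rw [hmul] at ht
  rw [add_mul, one_mul]
  omega

theorem clog_le_two_mul_logb {σ : ℕ} (hσ : 2 ≤ σ) :
    (Nat.clog 2 σ : ℝ) ≤ 2 * Real.logb 2 σ := by
  have hone : 1 ≤ Real.logb 2 σ := by
    rw [Real.le_logb_iff_rpow_le one_lt_two (by positivity), Real.rpow_one]
    exact_mod_cast hσ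
  rw [← Real.natCeil_logb_natCast, Nat.cast_ofNat]
  exact Nat.ceil_le_two_mul (by linarith)

theorem cast_time_le {n r t : ℕ} (hσ : 2 ≤ σ) (ht : t ≤ 23 * n + 90 * (r * Nat.clog 2 σ)) :
    (t : ℝ) ≤ 180 * (n + r * Real.logb 2 σ) := by
  have ht' : (t : ℝ) ≤ 23 * n + 90 * (r * Nat.clog 2 σ) := by exact_mod_cast ht
  have hlog : (r * Nat.clog 2 σ : ℝ) ≤ r * (2 * Real.logb 2 σ) := by
    gcongr
    exact clog_le_two_mul_logb hσ
  have : (0 : ℝ) ≤ n := n.cast_nonneg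
  linarith

theorem IsTerminated.two_le_card (hT : IsTerminated T) : 2 ≤ σ := by
  obtain ⟨hlen, u, d, rfl, hd⟩ := hT
  have hu : u ≠ [] := by
    rintro rfl
    simp at hlen
  have := Fintype.one_lt_card_iff.2 ⟨_, _, ne_of_mem_of_not_mem (u.head_mem hu) hd⟩
  rwa [Fintype.card_fin] at this

theorem fits_clog {n W M : ℕ} (hn : 2 ≤ n) (hσ : σ ≤ n) (hW : 8 * n ≤ W) (hM : 8 * n ≤ M) :
    Fits n σ (Nat.clog 2 σ) W M :=
  ⟨hn, hσ, Nat.le_pow_clog one_lt_two σ, fun _ => (Nat.lt_clog_iff_pow_lt one_lt_two).1, hW, hM⟩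

theorem IsText.isTerminated (hT : IsText T) : IsTerminated T := by
  obtain ⟨hlen, u, d, hud, -, hd⟩ := hT
  exact ⟨hlen, u, d, hud, hd⟩

end Time

end Suffixient

open Suffixient in
theorem mainTheorem11_general :
    ∃ (P : Prog) (C : ℕ), ∀ (σ : ℕ) (T : List (Fin σ)), IsTerminated T → σ ≤ T.length →
      IsSmallestSuffixient T (onePass T) ∧
      ∃ (t : ℕ) (s : State), Exec (C * T.length) (C * T.length) P (initState T) t s ∧
        s.out.Nodup ∧ s.out.toFinset = onePass T ∧
        (t : ℝ) ≤ C * (T.length + rBar T * Real.logb 2 σ) := by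
  refine ⟨onePassProg, 180, fun σ T hT hσ => ?_⟩
  obtain ⟨b, L, y, h⟩ : ∃ b L y, IsArrays T b L y := by
    obtain ⟨-, u, d, rfl, hd⟩ := hT
    exact exists_isArrays hd
  have hfits : Fits T.length σ (Nat.clog 2 σ) (180 * T.length) (180 * T.length) :=
    fits_clog hT.1 hσ (by omega) (by omega)
  obtain ⟨t, s, hexec, ht, hnodup, hout⟩ := run_onePassProg hfits h
  have hpos : 0 < Nat.clog 2 σ := Nat.clog_pos one_lt_two hT.two_le_card
  have htime := cast_time_le hT.two_le_card (h.time_le hT.1 hσ hpos ht)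
  exact ⟨h.isSmallestSuffixient_onePass hT, t, s, hexec, hnodup, hout, htime⟩

theorem mainTheorem11 :
    ∃ (P : Suffixient.Prog) (C : ℕ), ∀ (σ : ℕ) (T : List (Fin σ)),
      Suffixient.IsText T → σ ≤ T.length →
        Suffixient.IsSmallestSuffixient T (Suffixient.onePass T) ∧
        ∃ (t : ℕ) (s : Suffixient.State),
          Suffixient.Exec (C * T.length) (C * T.length) P (Suffixient.initState T) t s ∧
          s.out.Nodup ∧ s.out.toFinset = Suffixient.onePass T ∧
          (t : ℝ) ≤ C * (T.length + Suffixient.rBar T * Real.logb 2 σ) := by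
  obtain ⟨P, C, h⟩ := mainTheorem11_general
  exact ⟨P, C, fun σ T hT => h σ T hT.isTerminated⟩
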